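/- Theorem 4.5 (Pickrell's theorem). Let $\mathbb K \in \{\mathbb R, \mathbb C, \mathbb H\}$ and let $\mathcal H$ be a separable Hilbert space over $\mathbb K$, infinite-dimensional if $\mathbb K = \mathbb R$. Let $U(\mathcal H)$ be the group of surjective $\mathbb K$-linear isometries of $\mathcal H$, endowed with the topology defined by the operator norm, let $U_\infty(\mathcal H)$ be the subgroup of those $g \in U(\mathcal H)$ for which $g - \mathbf 1$ is a compact operator, and let $U_\infty(\mathcal H)_0$ be the identity component of $U_\infty(\mathcal H)$ (in the norm topology). Then every continuous unitary representation of the quotient group $U(\mathcal H)/U_\infty(\mathcal H)_0$ on a separable complex Hilbert space $V$ is trivial: if $\pi$ is a homomorphism from $U(\mathcal H)/U_\infty(\mathcal H)_0$ to the unitary group of $V$ for which all orbit maps $x \mapsto \pi(x)v$, $v \in V$, are continuous, then $\pi(x) = \mathbf 1$ for all $x$. -/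

import Mathlib

open Quaternion TopologicalSpace

universe u v

/-- A quaternionic inner product space: a right module over the quaternions `ℍ` (that is, a module
over `ℍᵐᵒᵖ`, with `MulOpposite.op q • x` playing the role of `x q`) with a definite `ℍ`-valued
hermitian form `⟪x, y⟫`, right linear in `y`, which induces the given norm. By `IsScalarTower`, the
real vector space structure is the one obtained by restricting scalars along `ℝ ⊆ ℍ`. Such a space
is a quaternionic Hilbert space when it is complete. -/
class QuaternionicInnerProductSpace (H : Type*) [NormedAddCommGroup H] [NormedSpace ℝ H]
    [Module ℍ[ℝ]ᵐᵒᵖ H] [IsScalarTower ℝ ℍ[ℝ]ᵐᵒᵖ H] where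
  /-- the quaternion-valued inner product -/
  qinner : H → H → ℍ[ℝ]
  qinner_add_right : ∀ x y z, qinner x (y + z) = qinner x y + qinner x z
  qinner_smul_right : ∀ x y (q : ℍ[ℝ]), qinner x (MulOpposite.op q • y) = qinner x y * q
  star_qinner : ∀ x y, star (qinner x y) = qinner y x
  qinner_self : ∀ x, qinner x x = ((‖x‖ ^ 2 : ℝ) : ℍ[ℝ])

section UnitaryGroups

variable (K H : Type*) [Ring K] [Algebra ℝ K] [NormedAddCommGroup H] [NormedSpace ℝ H]
  [Module K H] [IsScalarTower ℝ K H]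

/-- The unitary group `U_K(H)`: the group of surjective `K`-linear isometries of `H`. It is used
for `K = ℝ`, `K = ℂ` and (`H` being a right module) `K = ℍᵐᵒᵖ`. -/
abbrev UnitaryGroup : Type _ := H ≃ₗᵢ[K] H

namespace UnitaryGroup

variable {K H}

/-- The bounded operator underlying a unitary operator. Only the real linear structure is retained:
it suffices for computing operator norms. -/
noncomputable def toCLM : UnitaryGroup K H →* (H →L[ℝ] H) where
  toFun g := (g.toContinuousLinearEquiv : H →L[K] H).restrictScalars ℝ
  map_one' := rfl
  map_mul' _ _ := rfl

@[simp] theorem toCLM_apply (g : UnitaryGroup K H) (x : H) : toCLM g x = g x := rfl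

/-- The topology on `U_K(H)` defined by the operator norm. -/
noncomputable instance : TopologicalSpace (UnitaryGroup K H) :=
  TopologicalSpace.induced (fun g => toCLM g) inferInstance

theorem continuous_toCLM : Continuous (fun g : UnitaryGroup K H => toCLM g) :=
  continuous_induced_dom

theorem norm_toCLM_inv_sub_le (g h : UnitaryGroup K H) :
    ‖toCLM g⁻¹ - toCLM h⁻¹‖ ≤ ‖toCLM g - toCLM h‖ := by
  refine ContinuousLinearMap.opNorm_le_bound _ (norm_nonneg _) fun x => ?_
  have h1 : ‖(toCLM g⁻¹ - toCLM h⁻¹) x‖ = ‖(toCLM g - toCLM h) (h⁻¹ x)‖ := by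
    rw [← g.norm_map]
    simp only [sub_apply, toCLM_apply, map_sub]
    have e1 : g (g⁻¹ x) = x := g.apply_symm_apply x
    have e2 : h (h⁻¹ x) = x := h.apply_symm_apply x
    rw [e1, e2, norm_sub_rev]
  rw [h1]
  refine (ContinuousLinearMap.le_opNorm _ _).trans_eq ?_
  rw [LinearIsometryEquiv.norm_map]

instance : IsTopologicalGroup (UnitaryGroup K H) where
  continuous_mul := by
    refine continuous_induced_rng.2 ?_
    have : ((fun g : UnitaryGroup K H => toCLM g) ∘
        fun p : UnitaryGroup K H × UnitaryGroup K H => p.1 * p.2) =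
        fun p => toCLM p.1 * toCLM p.2 := by
      funext p; exact map_mul _ _ _
    rw [this]
    exact (continuous_toCLM.comp continuous_fst).mul (continuous_toCLM.comp continuous_snd)
  continuous_inv := by
    refine continuous_induced_rng.2 (continuous_iff_continuousAt.2 fun h => ?_)
    have h0 : Filter.Tendsto (fun g : UnitaryGroup K H => ‖toCLM g - toCLM h‖) (nhds h)
        (nhds 0) := by
      have := (continuous_toCLM (K := K) (H := H)).continuousAt (x := h)
      exact tendsto_iff_norm_sub_tendsto_zero.1 this
    exact tendsto_iff_norm_sub_tendsto_zero.2
      (squeeze_zero (fun _ => norm_nonneg _) (fun g => norm_toCLM_inv_sub_le g h) h0)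

variable (K H)

/-- `U_∞(H)`: the unitary operators `g` for which `g - 1` is a compact operator. -/
noncomputable def compactPerturbations : Subgroup (UnitaryGroup K H) where
  carrier := {g | IsCompactOperator (toCLM g - 1 : H →L[ℝ] H)}
  one_mem' := by
    change IsCompactOperator (toCLM (1 : UnitaryGroup K H) - 1 : H →L[ℝ] H)
    rw [map_one, sub_self]
    exact isCompactOperator_zero
  mul_mem' {g h} hg hh := by
    change IsCompactOperator (toCLM g - 1 : H →L[ℝ] H) at hg
    change IsCompactOperator (toCLM h - 1 : H →L[ℝ] H) at hh
    change IsCompactOperator (toCLM (g * h) - 1 : H →L[ℝ] H)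
    have e : toCLM (g * h) - 1 = (toCLM g - 1) ∘L toCLM h + (toCLM h - 1) := by
      ext x; simp
    rw [e]
    exact (hg.comp_clm (toCLM h)).add hh
  inv_mem' {g} hg := by
    change IsCompactOperator (toCLM g - 1 : H →L[ℝ] H) at hg
    change IsCompactOperator (toCLM g⁻¹ - 1 : H →L[ℝ] H)
    have e : toCLM g⁻¹ - 1 = -((toCLM g - 1) ∘L toCLM g⁻¹) := by
      ext x
      have e1 : g (g⁻¹ x) = x := g.apply_symm_apply x
      simp only [sub_apply, neg_apply,
        ContinuousLinearMap.comp_apply, toCLM_apply, one_apply_eq_self, e1, neg_sub]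
    rw [e]
    exact (hg.comp_clm (toCLM g⁻¹)).neg

/-- `U_∞(H)₀`: the identity component of the topological group `U_∞(H)` (with the topology defined
by the operator norm), as a subgroup of `U(H)`. -/
noncomputable def compactPerturbationsZero : Subgroup (UnitaryGroup K H) :=
  (Subgroup.connectedComponentOfOne (compactPerturbations K H)).map
    (compactPerturbations K H).subtype

instance : (compactPerturbations K H).Normal where
  conj_mem g hg h := by
    change IsCompactOperator (toCLM g - 1 : H →L[ℝ] H) at hg
    change IsCompactOperator (toCLM (h * g * h⁻¹) - 1 : H →L[ℝ] H)
    have e : toCLM (h * g * h⁻¹) - 1 = toCLM h ∘L ((toCLM g - 1) ∘L toCLM h⁻¹) := by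
      ext x
      have e1 : h (h⁻¹ x) = x := h.apply_symm_apply x
      simp only [map_mul, sub_apply, ContinuousLinearMap.comp_apply,
        mul_apply_eq_comp, toCLM_apply, one_apply_eq_self, map_sub, e1]
    rw [e]
    exact (hg.comp_clm (toCLM h⁻¹)).clm_comp (toCLM h)

instance : (compactPerturbationsZero K H).Normal where
  conj_mem := by
    rintro _ ⟨g, hg, rfl⟩ h
    let c : compactPerturbations K H → compactPerturbations K H := fun k =>
      ⟨h * k * h⁻¹, Subgroup.Normal.conj_mem inferInstance _ k.2 h⟩
    have hc : Continuous c :=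
      ((continuous_const.mul continuous_subtype_val).mul continuous_const).subtype_mk _
    have hc1 : c 1 = 1 := Subtype.ext (by simp [c])
    refine ⟨c g, ?_, rfl⟩
    have := hc.image_connectedComponent_subset 1 ⟨g, hg, rfl⟩
    rw [hc1] at this
    exact this

end UnitaryGroup

end UnitaryGroups

/-- A continuous unitary representation of a topological group `G` on a complex Hilbert space `V`:
a homomorphism into the unitary group of `V` whose orbit maps `g ↦ π(g) v` are continuous. -/
structure ContinuousUnitaryRep (G V : Type*) [Group G] [TopologicalSpace G]
    [NormedAddCommGroup V] [InnerProductSpace ℂ V] [CompleteSpace V] where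
  /-- the underlying homomorphism -/
  toHom : G →* unitary (V →L[ℂ] V)
  continuous_orbit : ∀ v : V, Continuous fun g => (toHom g : V →L[ℂ] V) v

/-- A representation is trivial if every group element acts as the identity. -/
def ContinuousUnitaryRep.IsTrivial {G V : Type*} [Group G] [TopologicalSpace G]
    [NormedAddCommGroup V] [InnerProductSpace ℂ V] [CompleteSpace V]
    (π : ContinuousUnitaryRep G V) : Prop :=
  ∀ (g : G) (v : V), (π.toHom g : V →L[ℂ] V) v = v

/-! Infinite dimension. Pull the representation back to `ρ` on the whole unitary group; the point is
to produce one reflection in `ρ.ker` whose two eigenspaces are infinite dimensional, and then to see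
that such a reflection normally generates the group.

To find it, split a basis into pairs `e i`, `f i` with `i` in `ℕ × ℤ` and rotate the `i`-th plane by
an angle `θ i`. This represents the additive group of functions `θ` on `V`; it is continuous for the
sup norm and trivial on finitely supported `θ`, since those rotations lie in the identity component.
Choose uncountably many pairwise almost disjoint infinite sets. Modulo finite supports, a finite sum
of their indicators is the indicator of a union, so sums of `π/m` times such indicators move a
vector little, uniformly in the number of terms. An averaging argument
(`exists_asymptotically_fixed`) turns this into: each vector is moved by only countably many of the
rotations by `π` on these sets. As `V` is separable, some such rotation acts trivially
(`exists_indicator_acts_trivially`), and it is the required reflection.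

All reflections of this type are conjugate, so the kernel contains them all (`IsRich`). Reflections
give swaps of orthogonal families, and two swaps give a bilateral shift. A swindle writes any
unitary fixing an infinite orthonormal family as a commutator with a shift (`IsRich.mem_of_fixes`),
and every unitary is two swaps times one of these (`IsRich.eq_top`).

Finite dimension, over `ℂ` or `ℍ`. Every operator is compact and the unitary group is generated by
quasi-reflections, which are joined to the identity because the unit scalars form a path connected
sphere. So the quotient is trivial. Over `ℝ` the unit scalars are `±1`, and this argument breaks
down. -/

set_option linter.unusedSectionVars false

open scoped InnerProductSpace

/-! ### Scalars and unitary operators, uniformly in the three fields -/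

/-- `HilbertScalars K H` says that the real Hilbert space `H`, with its action of `K`, behaves like
a Hilbert space over one of the fields `ℝ`, `ℂ`, `ℍ`: scalars have adjoints, and `K` has a finite
real spanning family acting by pairwise orthogonal isometries. -/
class HilbertScalars (K H : Type*) [Ring K] [Algebra ℝ K] [NormedAddCommGroup H]
    [InnerProductSpace ℝ H] [Module K H] : Prop where
  exists_adjoint : ∀ k : K, ∃ k' : K, ∀ x y : H, ⟪k • x, y⟫_ℝ = ⟪x, k' • y⟫_ℝ
  exists_frame : ∃ (n : ℕ) (β : Fin n → K), (∀ k : K, ∃ c : Fin n → ℝ, k = ∑ m, c m • β m) ∧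
    ∀ (x : H) (m m' : Fin n), ⟪β m • x, β m' • x⟫_ℝ = if m = m' then ‖x‖ ^ 2 else 0

namespace HilbertScalars

variable {K H ι κ : Type*} [Ring K] [Algebra ℝ K] [NormedAddCommGroup H]
  [InnerProductSpace ℝ H] [Module K H] [IsScalarTower ℝ K H]

section Scalars

variable [HilbertScalars K H]

variable (H) in
-- In frame coordinates the form is the Euclidean inner product of `k` and `l`, scaled by `‖x‖ ^ 2`.
-- This replaces the `K`-valued inner product wherever the latter would say that `⟪x, x⟫` is real.
theorem exists_inner_smul_self (k l : K) : ∃ τ : ℝ, ∀ x : H, ⟪k • x, l • x⟫_ℝ = τ * ‖x‖ ^ 2 := by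
  obtain ⟨n, β, hspan, hβ⟩ := exists_frame (K := K) (H := H)
  obtain ⟨c, rfl⟩ := hspan k
  obtain ⟨d, rfl⟩ := hspan l
  refine ⟨∑ m, c m * d m, fun x => ?_⟩
  simp only [Finset.sum_smul, smul_assoc, sum_inner, inner_sum, real_inner_smul_left,
    real_inner_smul_right, hβ]
  rw [Finset.sum_mul]
  refine Finset.sum_congr rfl fun m _ => ?_
  rw [Finset.sum_eq_single m (fun b _ hb => by simp [hb]) (by simp)]
  simp only [if_true]
  ring

variable (H) in
theorem exists_norm_smul (k : K) : ∃ c : ℝ, 0 ≤ c ∧ ∀ x : H, ‖k • x‖ = c * ‖x‖ := by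
  obtain ⟨τ, hτ⟩ := exists_inner_smul_self H k k
  refine ⟨√τ, Real.sqrt_nonneg _, fun x => ?_⟩
  have h := hτ x
  rw [real_inner_self_eq_norm_sq] at h
  by_cases hx : ‖x‖ = 0
  · rw [hx] at h ⊢
    simpa using h
  · have hτ0 : 0 ≤ τ := by
      have : 0 < ‖x‖ ^ 2 := by positivity
      by_contra hneg
      nlinarith [sq_nonneg ‖k • x‖]
    refine (sq_eq_sq₀ (norm_nonneg _) (by positivity)).1 ?_
    rw [h, mul_pow, Real.sq_sqrt hτ0]

variable (H) in
/-- Multiplication by a scalar, as a bounded real linear operator. -/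
noncomputable def smulCLM (k : K) : H →L[ℝ] H :=
  haveI := IsScalarTower.to_smulCommClass (R := ℝ) (A := K) (M := H)
  LinearMap.mkContinuous
    { toFun := fun x => k • x
      map_add' := smul_add k
      map_smul' := fun r x => (smul_comm r k x).symm }
    (exists_norm_smul H k).choose fun x => ((exists_norm_smul H k).choose_spec.2 x).le

@[simp] theorem smulCLM_apply (k : K) (x : H) : smulCLM H k x = k • x := rfl

theorem smul_real_smul (k : K) (r : ℝ) (x : H) : k • r • x = r • k • x :=
  (smulCLM H k).map_smul r x

end Scalars

section Unitary

@[simp] theorem mul_apply (g h : UnitaryGroup K H) (x : H) : (g * h) x = g (h x) := rfl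

@[simp] theorem one_apply (x : H) : (1 : UnitaryGroup K H) x = x := rfl

@[simp] theorem inv_apply_self (g : UnitaryGroup K H) (x : H) : g⁻¹ (g x) = x :=
  g.symm_apply_apply x

@[simp] theorem apply_inv_self (g : UnitaryGroup K H) (x : H) : g (g⁻¹ x) = x :=
  g.apply_symm_apply x

theorem map_real_smul (g : UnitaryGroup K H) (r : ℝ) (x : H) : g (r • x) = r • g x :=
  (UnitaryGroup.toCLM g).map_smul r x

theorem inner_map_map (g : UnitaryGroup K H) (x y : H) : ⟪g x, g y⟫_ℝ = ⟪x, y⟫_ℝ := by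
  rw [real_inner_eq_norm_add_mul_self_sub_norm_mul_self_sub_norm_mul_self_div_two, ← map_add,
    g.norm_map, g.norm_map, g.norm_map,
    ← real_inner_eq_norm_add_mul_self_sub_norm_mul_self_sub_norm_mul_self_div_two]

theorem inner_map_left (g : UnitaryGroup K H) (x y : H) : ⟪g x, y⟫_ℝ = ⟪x, g⁻¹ y⟫_ℝ := by
  rw [← inner_map_map g⁻¹, inv_apply_self]

end Unitary

/-! ### Orthogonality over `K`, orthonormal bases and their extension -/

variable (K) in
/-- Orthogonality with respect to the `K`-valued inner product. -/
def KOrth (x y : H) : Prop := ∀ k : K, ⟪k • x, y⟫_ℝ = 0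

theorem KOrth.inner_eq_zero {x y : H} (h : KOrth K x y) : ⟪x, y⟫_ℝ = 0 := by
  simpa using h 1

theorem KOrth.add_right {x y z : H} (hy : KOrth K x y) (hz : KOrth K x z) :
    KOrth K x (y + z) := fun k => by rw [inner_add_right, hy, hz, add_zero]

theorem KOrth.sub_right {x y z : H} (hy : KOrth K x y) (hz : KOrth K x z) :
    KOrth K x (y - z) := fun k => by rw [inner_sub_right, hy, hz, sub_zero]

theorem KOrth.real_smul_right {x y : H} (hy : KOrth K x y) (r : ℝ) :
    KOrth K x (r • y) := fun k => by rw [inner_smul_right, hy, mul_zero]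

theorem KOrth.smul_left {x y : H} (h : KOrth K x y) (k : K) : KOrth K (k • x) y :=
  fun l => by rw [smul_smul]; exact h _

theorem KOrth.map {x y : H} (h : KOrth K x y) (g : UnitaryGroup K H) : KOrth K (g x) (g y) :=
  fun k => by rw [← g.map_smul, inner_map_map]; exact h k

theorem kOrth_map_iff {x y : H} (g : UnitaryGroup K H) :
    KOrth K (g x) (g y) ↔ KOrth K x y :=
  ⟨fun h => by simpa using h.map g⁻¹, fun h => h.map g⟩

theorem kOrth_map_left {x y : H} (g : UnitaryGroup K H) :
    KOrth K (g x) y ↔ KOrth K x (g⁻¹ y) := by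
  rw [← kOrth_map_iff g⁻¹, inv_apply_self]

theorem kOrth_map_right {x y : H} (g : UnitaryGroup K H) :
    KOrth K x (g y) ↔ KOrth K (g⁻¹ x) y := by
  rw [← kOrth_map_iff g⁻¹, inv_apply_self]

section Orth

variable [HilbertScalars K H]

theorem KOrth.symm {x y : H} (h : KOrth K x y) : KOrth K y x := fun k => by
  obtain ⟨k', hk'⟩ := exists_adjoint (H := H) k
  rw [hk', real_inner_comm]
  exact h k'

theorem KOrth.smul_right {x y : H} (h : KOrth K x y) (k : K) : KOrth K x (k • y) :=
  (h.symm.smul_left k).symm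

theorem KOrth.inner_smul_smul {x y : H} (h : KOrth K x y) (k l : K) : ⟪k • x, l • y⟫_ℝ = 0 :=
  h.smul_right l k

end Orth

variable (K) in
/-- A family of unit vectors, pairwise orthogonal for the `K`-valued inner product. -/
structure KOrthonormal (e : ι → H) : Prop where
  norm_eq : ∀ i, ‖e i‖ = 1
  orth : ∀ i j, i ≠ j → KOrth K (e i) (e j)

variable (K) in
/-- A complete `K`-orthonormal family. -/
structure IsKBasis (e : ι → H) : Prop extends KOrthonormal K e where
  complete : ∀ x, (∀ i, KOrth K (e i) x) → x = 0

theorem KOrthonormal.comp {e : ι → H} (h : KOrthonormal K e) {f : κ → ι}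
    (hf : Function.Injective f) : KOrthonormal K (e ∘ f) :=
  ⟨fun _ => h.norm_eq _, fun _ _ hij => h.orth _ _ (hf.ne hij)⟩

theorem KOrthonormal.map {e : ι → H} (h : KOrthonormal K e) (g : UnitaryGroup K H) :
    KOrthonormal K (fun i => g (e i)) :=
  ⟨fun _ => by rw [g.norm_map, h.norm_eq], fun _ _ hij => (h.orth _ _ hij).map g⟩

theorem IsKBasis.comp_equiv {e : ι → H} (h : IsKBasis K e) (f : κ ≃ ι) : IsKBasis K (e ∘ f) :=
  ⟨h.toKOrthonormal.comp f.injective, fun x hx => h.complete x fun i => by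
    simpa using hx (f.symm i)⟩

section Sum

variable [HilbertScalars K H] {e : ι → H} {f : κ → H}

theorem kOrthonormal_sumElim_iff : KOrthonormal K (Sum.elim e f) ↔
    KOrthonormal K e ∧ KOrthonormal K f ∧ ∀ i j, KOrth K (e i) (f j) := by
  refine ⟨fun h => ⟨h.comp Sum.inl_injective, h.comp Sum.inr_injective,
    fun i j => h.orth (.inl i) (.inr j) Sum.inl_ne_inr⟩, fun ⟨he, hf, hef⟩ => ⟨?_, ?_⟩⟩
  · rintro (i | i)
    exacts [he.norm_eq i, hf.norm_eq i]
  · rintro (i | i) (j | j) hij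
    · exact he.orth i j fun h => hij (h ▸ rfl)
    · exact hef i j
    · exact (hef j i).symm
    · exact hf.orth i j fun h => hij (h ▸ rfl)

end Sum

theorem KOrthonormal.orthonormal {e : ι → H} (h : KOrthonormal K e) : Orthonormal ℝ e :=
  ⟨h.norm_eq, fun _ _ hij => (h.orth _ _ hij).inner_eq_zero⟩

theorem KOrthonormal.injective {e : ι → H} (h : KOrthonormal K e) : Function.Injective e :=
  h.orthonormal.linearIndependent.injective

/-- A closed real subspace containing all multiples of the members of a basis is everything. -/
theorem IsKBasis.mem_of_isClosed [CompleteSpace H] {e : ι → H} (h : IsKBasis K e)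
    (M : Submodule ℝ H)
    (hM : IsClosed (M : Set H)) (hk : ∀ i (k : K), k • e i ∈ M) (x : H) : x ∈ M := by
  have : CompleteSpace M := hM.completeSpace_coe
  have : M = ⊤ := by
    rw [← Submodule.orthogonal_eq_bot_iff, Submodule.eq_bot_iff]
    exact fun y hy => h.complete y fun i k => (Submodule.mem_orthogonal _ _).1 hy _ (hk i k)
  rw [this]; trivial

theorem IsKBasis.clm_ext [CompleteSpace H] {e : ι → H} (h : IsKBasis K e) {S T : H →L[ℝ] H}
    (hST : ∀ i (k : K), S (k • e i) = T (k • e i)) : S = T :=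
  ContinuousLinearMap.ext fun x => h.mem_of_isClosed
    (LinearMap.eqLocus (S : H →ₗ[ℝ] H) (T : H →ₗ[ℝ] H))
    (isClosed_eq S.continuous T.continuous) hST x

theorem IsKBasis.unitary_ext [CompleteSpace H] {e : ι → H} (h : IsKBasis K e)
    {g g' : UnitaryGroup K H} (hg : ∀ i, g (e i) = g' (e i)) : g = g' := by
  have := h.clm_ext (S := UnitaryGroup.toCLM g) (T := UnitaryGroup.toCLM g')
    (fun i k => by simp [map_smul, hg])
  exact LinearIsometryEquiv.ext fun x => congrArg (fun S : H →L[ℝ] H => S x) this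

section Complete

variable [HilbertScalars K H] [CompleteSpace H]

theorem IsKBasis.exists_hilbertBasis {e : ι → H} (h : IsKBasis K e) {n : ℕ} {β : Fin n → K}
    (hspan : ∀ k : K, ∃ c : Fin n → ℝ, k = ∑ m, c m • β m)
    (hβ : ∀ (x : H) (m m' : Fin n), ⟪β m • x, β m' • x⟫_ℝ = if m = m' then ‖x‖ ^ 2 else 0) :
    ∃ B : HilbertBasis (ι × Fin n) ℝ H, ∀ p, B p = β p.2 • e p.1 := by
  have ho : Orthonormal ℝ (fun p : ι × Fin n => β p.2 • e p.1) := by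
    classical
    rw [orthonormal_iff_ite]
    rintro ⟨i, m⟩ ⟨j, m'⟩
    by_cases hij : i = j
    · subst hij
      simp only [hβ, h.norm_eq, Prod.mk.injEq, true_and, one_pow]
    · rw [if_neg (by simp [hij])]
      exact (h.orth i j hij).inner_smul_smul _ _
  refine ⟨HilbertBasis.mkOfOrthogonalEqBot ho ?_, fun p => by
    rw [HilbertBasis.coe_mkOfOrthogonalEqBot]⟩
  rw [Submodule.eq_bot_iff]
  intro x hx
  refine h.complete x fun i k => ?_
  obtain ⟨c, rfl⟩ := hspan k
  simp only [Finset.sum_smul, smul_assoc, sum_inner, real_inner_smul_left]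
  refine Finset.sum_eq_zero fun m _ => ?_
  rw [(Submodule.mem_orthogonal _ _).1 hx _ (Submodule.subset_span ⟨(i, m), rfl⟩), mul_zero]

/-- Two bases with the same index type are related by a unitary operator. -/
theorem IsKBasis.exists_unitary {e f : ι → H} (he : IsKBasis K e) (hf : IsKBasis K f) :
    ∃ g : UnitaryGroup K H, ∀ i, g (e i) = f i := by
  classical
  obtain ⟨n, β, hspan, hβ⟩ := exists_frame (K := K) (H := H)
  obtain ⟨B, hB⟩ := he.exists_hilbertBasis hspan hβ
  obtain ⟨C, hC⟩ := hf.exists_hilbertBasis hspan hβ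
  -- The isometry is built over `ℝ`. It carries `k • e i` to `k • f i`, and `K`-linearity follows
  -- since these vectors span a dense real subspace.
  set g : H ≃ₗᵢ[ℝ] H := B.repr.trans C.repr.symm with hgdef
  have hg : ∀ i m, g (β m • e i) = β m • f i := fun i m => by
    have h1 := hB (i, m)
    have h2 := hC (i, m)
    simp only at h1 h2
    rw [← h1, ← h2, hgdef, LinearIsometryEquiv.trans_apply, B.repr_self, C.repr_symm_single]
  have hgk : ∀ i (k : K), g (k • e i) = k • f i := fun i k => by
    obtain ⟨c, rfl⟩ := hspan k
    simp [Finset.sum_smul, smul_assoc, hg]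
  have hlin : ∀ (k : K) x, g (k • x) = k • g x := fun k => by
    have := he.clm_ext (S := (g.toContinuousLinearEquiv : H →L[ℝ] H) ∘L smulCLM H k)
      (T := smulCLM H k ∘L (g.toContinuousLinearEquiv : H →L[ℝ] H))
      (fun i l => by simp [smul_smul, hgk])
    exact fun x => congrArg (fun S : H →L[ℝ] H => S x) this
  refine ⟨{ g with
    map_smul' := hlin
    norm_map' := g.norm_map }, fun i => ?_⟩
  have := hgk i 1
  rw [one_smul, one_smul] at this
  exact this

end Complete

section Extension

theorem exists_isKBasis_extension [HilbertScalars K H] {t : Set H}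
    (ht : KOrthonormal K ((↑) : t → H)) :
    ∃ s : Set H, t ⊆ s ∧ IsKBasis K ((↑) : s → H) := by
  obtain ⟨s, hts, hs⟩ := zorn_subset_nonempty {s : Set H | KOrthonormal K ((↑) : s → H)}
    (fun c hc hchain _ => by
      refine ⟨⋃₀ c, ⟨?_, ?_⟩, fun s hs => Set.subset_sUnion_of_mem hs⟩
      · rintro ⟨x, s, hs, hx⟩
        exact (hc hs).norm_eq ⟨x, hx⟩
      · rintro ⟨x, s, hs, hx⟩ ⟨y, s', hs', hy⟩ hxy
        rcases hchain.total hs hs' with hle | hle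
        · exact (hc hs').orth ⟨x, hle hx⟩ ⟨y, hy⟩ fun hh =>
            hxy (Subtype.ext (by simpa using hh))
        · exact (hc hs).orth ⟨x, hx⟩ ⟨y, hle hy⟩ fun hh =>
            hxy (Subtype.ext (by simpa using hh))) t ht
  refine ⟨s, hts, hs.prop, fun x hx => ?_⟩
  by_contra hx0
  have hn : ‖x‖ ≠ 0 := norm_ne_zero_iff.2 hx0
  set y : H := ‖x‖⁻¹ • x with hy
  have hyn : ‖y‖ = 1 := by rw [hy, norm_smul, norm_inv, norm_norm, inv_mul_cancel₀ hn]
  have hsy : ∀ z ∈ s, KOrth K z y := fun z hz => (hx ⟨z, hz⟩).real_smul_right _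
  have hmem : KOrthonormal K (Subtype.val : ↥(insert y s) → H) := by
    refine ⟨?_, ?_⟩
    · rintro ⟨z, rfl | hz⟩
      exacts [hyn, hs.prop.norm_eq ⟨z, hz⟩]
    · rintro ⟨z, rfl | hz⟩ ⟨w, rfl | hw⟩ hzw
      · exact absurd rfl hzw
      · exact (hsy w hw).symm
      · exact hsy z hz
      · exact hs.prop.orth ⟨z, hz⟩ ⟨w, hw⟩ fun hh => hzw (Subtype.ext (by simpa using hh))
  have hys : y ∈ s := hs.le_of_ge hmem (Set.subset_insert y s) (Set.mem_insert y s)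
  have := (hsy y hys).inner_eq_zero
  rw [real_inner_self_eq_norm_sq, hyn] at this
  norm_num at this

theorem KOrthonormal.range {e : ι → H} (h : KOrthonormal K e) :
    KOrthonormal K ((↑) : Set.range e → H) := by
  refine ⟨?_, ?_⟩
  · rintro ⟨_, i, rfl⟩
    exact h.norm_eq i
  · rintro ⟨_, i, rfl⟩ ⟨_, j, rfl⟩ hij
    exact h.orth i j fun hh => hij (by rw [hh])

theorem _root_.Orthonormal.countable_of_separable [SeparableSpace H] {e : ι → H}
    (h : Orthonormal ℝ e) : Countable ι := by
  refine Pairwise.countable_of_isOpen_disjoint (s := fun i => Metric.ball (e i) (1 / 2))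
    (fun i j hij => ?_) (fun _ => Metric.isOpen_ball) (fun i => ⟨e i, by simp⟩)
  refine Metric.ball_disjoint_ball ?_
  rw [dist_eq_norm]
  have : ‖e i - e j‖ ^ 2 = 2 := by
    rw [norm_sub_sq_real, h.1, h.1, h.2 hij]; norm_num
  nlinarith [norm_nonneg (e i - e j)]

/-- A `K`-orthonormal family with infinite dimensional orthogonal complement extends to a basis. -/
theorem KOrthonormal.exists_complement [HilbertScalars K H] [SeparableSpace H] [Infinite κ]
    {e : ι → H} {f : κ → H} (h : KOrthonormal K (Sum.elim e f)) :
    ∃ f' : ℕ → H, IsKBasis K (Sum.elim e f') := by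
  obtain ⟨s, hts, hs⟩ := exists_isKBasis_extension h.range
  have hcount : Countable s := hs.orthonormal.countable_of_separable
  have hes : ∀ i, e i ∈ s := fun i => hts ⟨.inl i, rfl⟩
  let t : Set H := s \ Set.range e
  have hinf : Infinite t := by
    refine Infinite.of_injective (fun j : κ => (⟨f j, hts ⟨.inr j, rfl⟩, ?_⟩ : t)) ?_
    · rintro ⟨i, hi⟩
      exact Sum.inl_ne_inr (h.injective (a₁ := .inl i) (a₂ := .inr j) hi)
    · intro i j hij
      exact Sum.inr_injective (h.injective (a₁ := .inr i) (a₂ := .inr j)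
        (congrArg Subtype.val hij))
  have hct : Countable t := (Set.to_countable s).mono Set.sdiff_subset
  obtain ⟨φ⟩ := nonempty_equiv_of_countable (α := ℕ) (β := t)
  refine ⟨fun n => φ n, kOrthonormal_sumElim_iff.2 ⟨h.comp Sum.inl_injective, ?_, ?_⟩, ?_⟩
  · exact ⟨fun n => hs.norm_eq ⟨φ n, (φ n).2.1⟩, fun m n hmn =>
      hs.orth ⟨φ m, (φ m).2.1⟩ ⟨φ n, (φ n).2.1⟩ fun hh =>
        hmn (φ.injective (Subtype.ext (by simpa using hh)))⟩
  · intro i n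
    exact hs.orth ⟨e i, hes i⟩ ⟨φ n, (φ n).2.1⟩ fun hh =>
      (φ n).2.2 ⟨i, by simpa using hh⟩
  · intro x hx
    refine hs.complete x ?_
    rintro ⟨y, hy⟩
    by_cases hye : y ∈ Set.range e
    · obtain ⟨i, rfl⟩ := hye
      exact hx (.inl i)
    · have := hx (.inr (φ.symm ⟨y, hy, hye⟩))
      simpa using this

end Extension

end HilbertScalars

namespace HilbertScalars

variable {K H ι κ : Type*} [Ring K] [Algebra ℝ K] [NormedAddCommGroup H]
  [InnerProductSpace ℝ H] [Module K H] [IsScalarTower ℝ K H] [HilbertScalars K H]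

/-! ### Rotations in orthogonal planes -/

section Rotate

theorem KOrth.add_left {x y z : H} (hx : KOrth K x z) (hy : KOrth K y z) : KOrth K (x + y) z :=
  (hx.symm.add_right hy.symm).symm

theorem KOrth.sub_left {x y z : H} (hx : KOrth K x z) (hy : KOrth K y z) : KOrth K (x - y) z :=
  (hx.symm.sub_right hy.symm).symm

theorem KOrth.real_smul_left {x y : H} (h : KOrth K x y) (r : ℝ) : KOrth K (r • x) y :=
  (h.symm.real_smul_right r).symm

theorem norm_rotate {x y : H} (hx : ‖x‖ = 1) (hy : ‖y‖ = 1) (hxy : KOrth K x y) {c s : ℝ}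
    (hcs : c ^ 2 + s ^ 2 = 1) : ‖c • x + s • y‖ = 1 := by
  have h : ‖c • x + s • y‖ ^ 2 = 1 := by
    rw [norm_add_sq_real, norm_smul, norm_smul, hx, hy, real_inner_smul_left,
      real_inner_smul_right, hxy.inner_eq_zero]
    simpa using hcs
  nlinarith [norm_nonneg (c • x + s • y)]

/-- The number `⟪k • x, x⟫_ℝ` is the same for all unit vectors `x`, so the two diagonal terms
cancel; the mixed terms vanish by orthogonality. -/
theorem kOrth_rotate {x y : H} (hx : ‖x‖ = 1) (hy : ‖y‖ = 1) (hxy : KOrth K x y) (c s : ℝ) :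
    KOrth K (c • x + s • y) (c • y - s • x) := fun k => by
  obtain ⟨τ, hτ⟩ := exists_inner_smul_self H k 1
  simp only [one_smul] at hτ
  simp only [smul_add, smul_real_smul, inner_add_left, inner_sub_right, real_inner_smul_left,
    real_inner_smul_right, hτ, hx, hy, hxy k, hxy.symm k]
  ring

/-- Rotating a family of orthogonal planes. -/
theorem KOrthonormal.rotate {e f : ι → H} (h : KOrthonormal K (Sum.elim e f)) {c s : ι → ℝ}
    (hcs : ∀ i, c i ^ 2 + s i ^ 2 = 1) :
    KOrthonormal K (Sum.elim (fun i => c i • e i + s i • f i)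
      (fun i => c i • f i - s i • e i)) := by
  obtain ⟨he, hf, hef⟩ := kOrthonormal_sumElim_iff.1 h
  refine kOrthonormal_sumElim_iff.2 ⟨⟨fun i => ?_, fun i j hij => ?_⟩,
    ⟨fun i => ?_, fun i j hij => ?_⟩, fun i j => ?_⟩
  · exact norm_rotate (he.norm_eq i) (hf.norm_eq i) (hef i i) (hcs i)
  · exact (((he.orth i j hij).real_smul_right _).add_right
      ((hef i j).real_smul_right _)).real_smul_left _ |>.add_left
      ((((hef j i).symm.real_smul_right _).add_right
      ((hf.orth i j hij).real_smul_right _)).real_smul_left _)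
  · rw [sub_eq_add_neg, ← neg_smul]
    exact norm_rotate (hf.norm_eq i) (he.norm_eq i) (hef i i).symm (by rw [neg_sq, hcs])
  · exact (((hf.orth i j hij).real_smul_right _).sub_right
      ((hef j i).symm.real_smul_right _)).real_smul_left _ |>.sub_left
      ((((hef i j).real_smul_right _).sub_right
      ((he.orth i j hij).real_smul_right _)).real_smul_left _)
  · by_cases hij : i = j
    · subst hij
      exact kOrth_rotate (he.norm_eq i) (hf.norm_eq i) (hef i i) _ _
    · exact (((hef i j).real_smul_right _).sub_right
        ((he.orth i j hij).real_smul_right _)).real_smul_left _ |>.add_left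
        ((((hf.orth i j hij).real_smul_right _).sub_right
        ((hef j i).symm.real_smul_right _)).real_smul_left _)

theorem rotate_back_left {x y : H} {c s : ℝ} (hcs : c ^ 2 + s ^ 2 = 1) :
    c • (c • x + s • y) - s • (c • y - s • x) = x := by
  calc _ = (c ^ 2 + s ^ 2) • x := by module
    _ = x := by rw [hcs, one_smul]

theorem rotate_back_right {x y : H} {c s : ℝ} (hcs : c ^ 2 + s ^ 2 = 1) :
    s • (c • x + s • y) + c • (c • y - s • x) = y := by
  calc _ = (c ^ 2 + s ^ 2) • y := by module
    _ = y := by rw [hcs, one_smul]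

theorem IsKBasis.rotate {e f : ι → H} (h : IsKBasis K (Sum.elim e f)) {c s : ι → ℝ}
    (hcs : ∀ i, c i ^ 2 + s i ^ 2 = 1) :
    IsKBasis K (Sum.elim (fun i => c i • e i + s i • f i)
      (fun i => c i • f i - s i • e i)) := by
  refine ⟨h.toKOrthonormal.rotate hcs, fun x hx => h.complete x ?_⟩
  rintro (i | i)
  · have := ((hx (.inl i)).real_smul_left (c i)).sub_left ((hx (.inr i)).real_smul_left (s i))
    simpa only [Sum.elim_inl, Sum.elim_inr, rotate_back_left (hcs i)] using this
  · have := ((hx (.inl i)).real_smul_left (s i)).add_left ((hx (.inr i)).real_smul_left (c i))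
    simpa only [Sum.elim_inl, Sum.elim_inr, rotate_back_right (hcs i)] using this

end Rotate

/-! ### Reflections and swaps in a normal subgroup -/

section Reflection

variable (K) in
/-- `r` is `-1` on the family `e` and the identity on its orthogonal complement. -/
structure IsReflection (r : UnitaryGroup K H) (e : ι → H) : Prop where
  apply_eq : ∀ i, r (e i) = -e i
  apply_of_orth : ∀ x, (∀ i, KOrth K (e i) x) → r x = x

theorem IsReflection.conj {r : UnitaryGroup K H} {e : ι → H} (h : IsReflection K r e)
    (g : UnitaryGroup K H) : IsReflection K (g * r * g⁻¹) (fun i => g (e i)) :=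
  ⟨fun i => by simp [h.apply_eq], fun x hx => by
    rw [mul_apply, mul_apply, h.apply_of_orth (g⁻¹ x) fun i => (kOrth_map_left g).1 (hx i),
      apply_inv_self]⟩

theorem IsReflection.comp_equiv {r : UnitaryGroup K H} {e : ι → H} (h : IsReflection K r e)
    (φ : κ ≃ ι) : IsReflection K r (e ∘ φ) :=
  ⟨fun i => h.apply_eq (φ i), fun x hx => h.apply_of_orth x fun i => by simpa using hx (φ.symm i)⟩

variable [CompleteSpace H] [SeparableSpace H]

/-- The unitary group acts transitively on orthonormal families with infinite dimensional
orthogonal complement. -/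
theorem exists_unitary_of_complement {κ' : Type*} [Infinite κ] [Infinite κ'] {e e' : ι → H}
    {f : κ → H} {f' : κ' → H} (h : KOrthonormal K (Sum.elim e f))
    (h' : KOrthonormal K (Sum.elim e' f')) : ∃ g : UnitaryGroup K H, ∀ i, g (e i) = e' i := by
  obtain ⟨b, hb⟩ := h.exists_complement
  obtain ⟨b', hb'⟩ := h'.exists_complement
  obtain ⟨g, hg⟩ := hb.exists_unitary hb'
  exact ⟨g, fun i => hg (.inl i)⟩

/-- A subgroup is rich if it contains all reflections with infinite dimensional eigenspaces. -/
def IsRich (N : Subgroup (UnitaryGroup K H)) : Prop :=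
  ∀ (e f : ℕ → H), KOrthonormal K (Sum.elim e f) → ∃ r ∈ N, IsReflection K r e

/-- Reflections with both eigenspaces infinite dimensional form one conjugacy class, because the
unitary group is transitive on the families defining them. -/
theorem isRich_of_mem {N : Subgroup (UnitaryGroup K H)} [N.Normal] [Countable ι] [Infinite ι]
    [Infinite κ] {e : ι → H} {f : κ → H} (h : KOrthonormal K (Sum.elim e f))
    {r : UnitaryGroup K H} (hr : IsReflection K r e) (hrN : r ∈ N) : IsRich N := by
  intro e' f' h'
  obtain ⟨φ⟩ := nonempty_equiv_of_countable (α := ℕ) (β := ι)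
  have h2 : KOrthonormal K (Sum.elim (e ∘ φ) f) := by
    have := h.comp (f := Sum.map φ id) (Sum.map_injective.2 ⟨φ.injective, Function.injective_id⟩)
    rwa [Sum.elim_comp_map] at this
  obtain ⟨g, hg⟩ := exists_unitary_of_complement h2 h'
  refine ⟨g * r * g⁻¹, Subgroup.Normal.conj_mem inferInstance r hrN g, ?_⟩
  have := (hr.comp_equiv φ).conj g
  rwa [show (fun i => g ((e ∘ φ) i)) = e' from funext hg] at this

theorem IsRich.exists_reflection {N : Subgroup (UnitaryGroup K H)} (hN : IsRich N) [Countable ι]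
    [Infinite ι] {e f : ι → H} (h : KOrthonormal K (Sum.elim e f)) :
    ∃ r ∈ N, IsReflection K r e := by
  obtain ⟨φ⟩ := nonempty_equiv_of_countable (α := ℕ) (β := ι)
  have h2 : KOrthonormal K (Sum.elim (e ∘ φ) (f ∘ φ)) := by
    have := h.comp (f := Sum.map φ φ) (Sum.map_injective.2 ⟨φ.injective, φ.injective⟩)
    rwa [Sum.elim_comp_map] at this
  obtain ⟨r, hrN, hr⟩ := hN _ _ h2
  refine ⟨r, hrN, ?_⟩
  have := hr.comp_equiv φ.symm
  rwa [Function.comp_assoc, φ.self_comp_symm, Function.comp_id] at this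

/-- A rich subgroup contains the operators which swap two infinite orthonormal families. -/
theorem IsRich.exists_swap {N : Subgroup (UnitaryGroup K H)} (hN : IsRich N) [Countable ι]
    [Infinite ι] {e f : ι → H} (h : KOrthonormal K (Sum.elim e f)) :
    ∃ r ∈ N, (∀ i, r (e i) = f i) ∧ (∀ i, r (f i) = e i) ∧
      ∀ x, (∀ i, KOrth K (e i) x) → (∀ i, KOrth K (f i) x) → r x = x := by
  -- The swap is the reflection in the vectors `(e i - f i) / √2`. Rotating by `-π/4` produces these
  -- together with the fixed vectors `(e i + f i) / √2`, which provide the infinite complement.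
  set a : ℝ := √2 / 2 with ha
  have h2 : a ^ 2 + (-a) ^ 2 = 1 := by
    rw [neg_sq, ha, div_pow, Real.sq_sqrt (by norm_num)]; norm_num
  obtain ⟨r, hrN, hr⟩ := hN.exists_reflection
    (h.rotate (c := fun _ => a) (s := fun _ => -a) fun _ => h2)
  have hef := kOrthonormal_sumElim_iff.1 (h.rotate (c := fun _ => a) (s := fun _ => -a)
    fun _ => h2)
  have h1 : ∀ i, r (a • f i - (-a) • e i) = a • f i - (-a) • e i := fun i =>
    hr.apply_of_orth _ fun j => hef.2.2 j i
  have h3 : ∀ i, r (a • e i + (-a) • f i) = -(a • e i + (-a) • f i) := hr.apply_eq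
  refine ⟨r, hrN, fun i => ?_, fun i => ?_, fun x hx hx' => ?_⟩
  · rw [← rotate_back_left (x := e i) (y := f i) h2, map_sub, map_real_smul, map_real_smul, h1,
      h3]
    calc _ = (a ^ 2 + (-a) ^ 2) • f i := by module
      _ = f i := by rw [h2, one_smul]
  · rw [← rotate_back_right (x := e i) (y := f i) h2, map_add, map_real_smul, map_real_smul, h1,
      h3]
    calc _ = (a ^ 2 + (-a) ^ 2) • e i := by module
      _ = e i := by rw [h2, one_smul]
  · exact hr.apply_of_orth x fun i =>
      ((hx i).real_smul_left _).add_left ((hx' i).real_smul_left _)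

end Reflection

/-! ### Shifts, the swindle, and generation of the whole group -/

section Swindle

variable [CompleteSpace H] [SeparableSpace H]

/-- A rich subgroup contains the shift of a basis indexed by `ℤ × ℕ`. -/
theorem IsRich.exists_shift {N : Subgroup (UnitaryGroup K H)} (hN : IsRich N) {b : ℤ × ℕ → H}
    (hb : IsKBasis K b) : ∃ T ∈ N, ∀ k i, T (b (k, i)) = b (k + 1, i) := by
  have key : ∀ u v : ℕ → ℤ, Function.Injective (Sum.elim u v) →
      KOrthonormal K (Sum.elim (fun p : ℕ × ℕ => b (u p.1, p.2))
        (fun p : ℕ × ℕ => b (v p.1, p.2))) := fun u v huv => by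
    have := hb.toKOrthonormal.comp (f := Sum.elim (fun p : ℕ × ℕ => (u p.1, p.2))
      (fun p : ℕ × ℕ => (v p.1, p.2))) (by
        rintro (⟨p, i⟩ | ⟨p, i⟩) (⟨q, j⟩ | ⟨q, j⟩) hpq <;>
          simp only [Sum.elim_inl, Sum.elim_inr, Prod.mk.injEq] at hpq
        · have := huv (a₁ := .inl p) (a₂ := .inl q) hpq.1
          simp_all
        · exact absurd (huv (a₁ := .inl p) (a₂ := .inr q) hpq.1) Sum.inl_ne_inr
        · exact absurd (huv (a₁ := .inr p) (a₂ := .inl q) hpq.1) Sum.inr_ne_inl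
        · have := huv (a₁ := .inr p) (a₂ := .inr q) hpq.1
          simp_all)
    rwa [Sum.comp_elim] at this
  -- Translation of `ℤ` by one is the product of the point reflections `k ↦ -k` and `k ↦ 1 - k`.
  -- Each swaps two infinite families of basis vectors, and the first also fixes the block `0`.
  obtain ⟨F, hFN, hF1, hF2, hF3⟩ := hN.exists_swap (key (fun n => n + 1) (fun n => -n - 1) (by
    rintro (p | p) (q | q) hpq <;> simp only [Sum.elim_inl, Sum.elim_inr] at hpq
    · congr 1; lia
    · lia
    · lia
    · congr 1; lia))
  obtain ⟨G, hGN, hG1, hG2, -⟩ := hN.exists_swap (key (fun n => n + 1) (fun n => -n) (by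
    rintro (p | p) (q | q) hpq <;> simp only [Sum.elim_inl, Sum.elim_inr] at hpq
    · congr 1; lia
    · lia
    · lia
    · congr 1; lia))
  have hF : ∀ k i, F (b (k, i)) = b (-k, i) := fun k i => by
    rcases lt_trichotomy k 0 with hk | rfl | hk
    · have := hF2 ((-k - 1).toNat, i)
      simp only at this
      rwa [show -((-k - 1).toNat : ℤ) - 1 = k by lia,
        show ((-k - 1).toNat : ℤ) + 1 = -k by lia] at this
    · rw [neg_zero]
      refine hF3 _ (fun p => hb.orth _ _ fun h => ?_) (fun p => hb.orth _ _ fun h => ?_) <;>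
      · have := congrArg Prod.fst h
        simp only at this
        lia
    · have := hF1 ((k - 1).toNat, i)
      simp only at this
      rwa [show ((k - 1).toNat : ℤ) + 1 = k by lia,
        show -((k - 1).toNat : ℤ) - 1 = -k by lia] at this
  have hG : ∀ k i, G (b (k, i)) = b (1 - k, i) := fun k i => by
    rcases le_or_gt k 0 with hk | hk
    · have := hG2 ((-k).toNat, i)
      simp only at this
      rwa [show -((-k).toNat : ℤ) = k by lia, show ((-k).toNat : ℤ) + 1 = 1 - k by lia] at this
    · have := hG1 ((k - 1).toNat, i)
      simp only at this
      rwa [show ((k - 1).toNat : ℤ) + 1 = k by lia,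
        show -((k - 1).toNat : ℤ) = 1 - k by lia] at this
  exact ⟨G * F, mul_mem hGN hFN, fun k i => by
    rw [mul_apply, hF, hG, sub_neg_eq_add, add_comm]⟩

theorem zpow_shift_apply {T : UnitaryGroup K H} {b : ℤ × ℕ → H}
    (hT : ∀ k i, T (b (k, i)) = b (k + 1, i)) (n k : ℤ) (i : ℕ) :
    (T ^ n) (b (k, i)) = b (k + n, i) := by
  induction n using Int.induction_on generalizing k with
  | zero => simp
  | succ n ih => rw [zpow_add_one, mul_apply, hT, ih]; congr 2; ring
  | pred n ih =>
    have : T⁻¹ (b (k, i)) = b (k - 1, i) := by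
      rw [← inv_apply_self T (b (k - 1, i)), hT, sub_add_cancel]
    rw [zpow_sub_one, mul_apply, this, ih]; congr 2; ring

/-- Vectors supported on complementary parts of a basis are orthogonal. -/
theorem IsKBasis.kOrth_of_forall {b : ι → H} (hb : IsKBasis K b) {x y : H}
    (h : ∀ i, KOrth K (b i) x ∨ KOrth K (b i) y) : KOrth K x y := by
  obtain ⟨n, β, hspan, hβ⟩ := exists_frame (K := K) (H := H)
  obtain ⟨B, hB⟩ := hb.exists_hilbertBasis hspan hβ
  intro k
  refine (B.hasSum_inner_mul_inner (k • x) y).unique ?_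
  convert hasSum_zero with p
  rw [hB]
  rcases h p.1 with hp | hp
  · rw [hp.symm.inner_smul_smul, zero_mul]
  · rw [hp, mul_zero]

/-- A normal rich subgroup contains every operator fixing an infinite orthonormal family. -/
theorem IsRich.mem_of_fixes {N : Subgroup (UnitaryGroup K H)} [N.Normal] (hN : IsRich N)
    {e f : ℕ → H} (hef : KOrthonormal K (Sum.elim e f)) {h : UnitaryGroup K H}
    (hh : ∀ i, h (e i) = e i) : h ∈ N := by
  obtain ⟨f', hb'⟩ := hef.exists_complement
  have : Infinite {k : ℤ // k ≠ 0} :=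
    Infinite.of_injective (fun n : ℕ => ⟨(n : ℤ) + 1, by lia⟩) fun m n hmn => by
      have := congrArg Subtype.val hmn
      simp only at this
      lia
  obtain ⟨φ⟩ := nonempty_equiv_of_countable (α := {k : ℤ // k ≠ 0} × ℕ) (β := ℕ)
  -- The fixed family `e` is cut into infinitely many infinite blocks, indexed by the nonzero
  -- integers. The complement, where `h` acts nontrivially, becomes the block `0`.
  obtain ⟨b, hb, hb0, hb1⟩ : ∃ b : ℤ × ℕ → H, IsKBasis K b ∧ (∀ i, b (0, i) = f' i) ∧
      ∀ k (hk : k ≠ 0) i, b (k, i) = e (φ (⟨k, hk⟩, i)) := by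
    let ψ : ℤ × ℕ ≃ ℕ ⊕ ℕ :=
      { toFun := fun p => if hp : p.1 = 0 then .inr p.2 else .inl (φ (⟨p.1, hp⟩, p.2))
        invFun := Sum.elim (fun n => (((φ.symm n).1 : ℤ), (φ.symm n).2)) (fun n => (0, n))
        left_inv := fun p => by
          by_cases hp : p.1 = 0
          · simp [hp, Prod.ext_iff]
          · simp [hp]
        right_inv := by
          rintro (n | n)
          · have := (φ.symm n).1.2
            simp [this]
          · simp }
    refine ⟨Sum.elim e f' ∘ ψ, hb'.comp_equiv ψ, fun i => ?_, fun k hk i => ?_⟩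
    · simp [ψ]
    · simp [ψ, hk]
  have hb1' : ∀ n, ∃ k i, k ≠ 0 ∧ e n = b (k, i) := fun n =>
    ⟨(φ.symm n).1, (φ.symm n).2, (φ.symm n).1.2, by rw [hb1 _ (φ.symm n).1.2]; simp⟩
  have hfix : ∀ k, k ≠ 0 → ∀ i, h (b (k, i)) = b (k, i) := fun k hk i => by
    rw [hb1 k hk, hh]
  obtain ⟨T, hTN, hT⟩ := hN.exists_shift hb
  have hTn := zpow_shift_apply hT
  have hTn' : ∀ n : ℤ, ∀ k i, (T ^ n)⁻¹ (b (k, i)) = b (k - n, i) := fun n k i => by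
    rw [← zpow_neg, hTn, sub_eq_add_neg]
  -- the block diagonal operator acting by copies of `h` on the blocks of nonnegative index
  let c : ℤ × ℕ → H := fun p => if 0 ≤ p.1 then (T ^ p.1) (h (b (0, p.2))) else b p
  have hh0 : ∀ i k j, k ≠ 0 → KOrth K (h (b (0, i))) (b (k, j)) := fun i k j hk => by
    rw [← hfix k hk, kOrth_map_iff]
    exact hb.orth _ _ fun hq => hk (congrArg Prod.fst hq).symm
  have hfix' : ∀ y, (∀ i, KOrth K (b (0, i)) y) → h y = y := fun y hy => by
    rw [← sub_eq_zero]
    refine hb.complete _ ?_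
    rintro ⟨l, i⟩
    by_cases hl : l = 0
    · subst hl
      refine KOrth.sub_right ?_ (hy i)
      rw [kOrth_map_right]
      refine hb.kOrth_of_forall ?_
      rintro ⟨l, j⟩
      by_cases hl : l = 0
      · subst hl
        exact .inr (hy j)
      · exact .inl (by rw [kOrth_map_right, inv_inv, hfix l hl]; exact hb.orth _ _ (by simp [hl]))
    · intro k
      rw [inner_sub_right, sub_eq_zero, ← inner_map_map h (k • b (l, i)) y, map_smul, hfix l hl]
  have hcb : ∀ k i l j, 0 ≤ k → k ≠ l → KOrth K (c (k, i)) (b (l, j)) := fun k i l j hk hkl => by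
    simp only [c, hk, if_true]
    rw [kOrth_map_left, hTn']
    exact hh0 _ _ _ (sub_ne_zero.2 hkl.symm)
  have hc : IsKBasis K c := by
    refine ⟨⟨?_, ?_⟩, fun x hx => hb.complete x ?_⟩
    · rintro ⟨k, i⟩
      by_cases hk : 0 ≤ k
      · simp only [c, hk, if_true, LinearIsometryEquiv.norm_map, hb.norm_eq]
      · simp only [c, hk, if_false, hb.norm_eq]
    · rintro ⟨k, i⟩ ⟨l, j⟩ hkl
      by_cases hk : 0 ≤ k <;> by_cases hl : 0 ≤ l
      · by_cases hkl' : k = l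
        · subst hkl'
          simp only [c, hk, if_true, kOrth_map_iff]
          exact hb.orth _ _ fun hq => hkl (by
            have := congrArg Prod.snd hq
            simp only at this
            rw [this])
        · refine hb.kOrth_of_forall fun p => ?_
          by_cases hp : p.1 = k
          · exact .inr (hcb l j p.1 p.2 hl (by lia)).symm
          · exact .inl (hcb k i p.1 p.2 hk (by lia)).symm
      · have := hcb k i l j hk (by lia)
        simpa only [c, hl, if_false] using this
      · have := (hcb l j k i hl (by lia)).symm
        simpa only [c, hk, if_false] using this
      · simp only [c, hk, hl, if_false]
        exact hb.orth _ _ hkl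
    · rintro ⟨k, i⟩
      by_cases hk : 0 ≤ k
      · have hz : h ((h⁻¹ * (T ^ k)⁻¹) x) = (h⁻¹ * (T ^ k)⁻¹) x := hfix' _ fun j => by
          have := hx (k, j)
          simp only [c, hk, if_true] at this
          rwa [kOrth_map_left, kOrth_map_left] at this
        have h2 := hx (k, i)
        simp only [c, hk, if_true] at h2
        rw [kOrth_map_left, kOrth_map_left, ← mul_apply, ← hz, mul_apply, apply_inv_self,
          kOrth_map_right, inv_inv, hTn, zero_add] at h2
        exact h2
      · have := hx (k, i)
        simpa only [c, hk, if_false] using this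
  obtain ⟨D, hD⟩ := hb.exists_unitary hc
  -- `D` acts as a copy of `h` on every block of index at least `0`, and `T * D⁻¹ * T⁻¹` as a copy
  -- of `h⁻¹` on every block of index at least `1`. In the product only the copy on block `0`
  -- survives. Membership in `N` needs only `T ∈ N` and normality; `D` may lie outside `N`.
  have hcomm : h = D * T * D⁻¹ * T⁻¹ := by
    have : h * T * D = D * T := hb.unitary_ext fun ⟨k, i⟩ => by
      simp only [mul_apply, hD, hT]
      by_cases hk : 0 ≤ k
      · have h1 : T (c (k, i)) = c (k + 1, i) := by
          simp only [c, hk, (by lia : 0 ≤ k + 1), if_true]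
          rw [← mul_apply, ← zpow_one_add, add_comm]
        rw [h1]
        exact hfix' _ fun j => (hcb _ _ _ _ (by lia) (by lia)).symm
      · have h1 : c (k, i) = b (k, i) := by simp only [c, hk, if_false]
        rw [h1, hT]
        by_cases hk' : k = -1
        · subst hk'
          simp [c]
        · rw [hfix _ (by lia)]
          simp only [c, (by lia : ¬ 0 ≤ k + 1), if_false]
    rw [← this]; group
  rw [hcomm]
  exact mul_mem (Subgroup.Normal.conj_mem inferInstance T hTN D) (inv_mem hTN)

/-- In infinite dimension, there are vectors orthogonal to any given finite set. -/
theorem exists_unit_kOrth (hinf : ¬ FiniteDimensional ℝ H) (s : Finset H) :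
    ∃ y : H, ‖y‖ = 1 ∧ ∀ x ∈ s, KOrth K x y := by
  classical
  obtain ⟨n, β, hspan, hβ⟩ := exists_frame (K := K) (H := H)
  let t : Finset H := Finset.image₂ (fun m x => β m • x) Finset.univ s
  have ht : Submodule.span ℝ (t : Set H) ≠ ⊤ := fun h =>
    hinf (Module.finite_def.2 ⟨t, h⟩)
  have hfd : FiniteDimensional ℝ (Submodule.span ℝ (t : Set H)) :=
    FiniteDimensional.span_finset ℝ t
  have hne : (Submodule.span ℝ (t : Set H))ᗮ ≠ ⊥ := fun h =>
    ht (Submodule.orthogonal_eq_bot_iff.1 h)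
  obtain ⟨z, hz, hz0⟩ := Submodule.exists_mem_ne_zero_of_ne_bot hne
  have hn : ‖z‖ ≠ 0 := norm_ne_zero_iff.2 hz0
  refine ⟨‖z‖⁻¹ • z, by rw [norm_smul, norm_inv, norm_norm, inv_mul_cancel₀ hn],
    fun x hx => KOrth.real_smul_right (fun k => ?_) _⟩
  obtain ⟨c, rfl⟩ := hspan k
  simp only [Finset.sum_smul, smul_assoc, sum_inner, real_inner_smul_left]
  refine Finset.sum_eq_zero fun m _ => ?_
  rw [(Submodule.mem_orthogonal _ _).1 hz _ (Submodule.subset_span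
    (Finset.mem_coe.2 (Finset.mem_image₂_of_mem (Finset.mem_univ m) hx))), mul_zero]

/-- For every unitary `g` there is an orthonormal sequence whose members generate pairwise
orthogonal subspaces together with their images under `g`. -/
theorem exists_seq_kOrth_map (hinf : ¬ FiniteDimensional ℝ H) (g : UnitaryGroup K H) :
    ∃ x : ℕ → H, KOrthonormal K x ∧ ∀ m n, m ≠ n → KOrth K (x m) (g (x n)) := by
  classical
  -- Each new vector avoids the earlier `y`, `g y` and `g⁻¹ y`. The last two give orthogonality of
  -- `x m` and `g (x n)` for `n < m` and for `m < n` respectively.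
  obtain ⟨x, hx1, hx⟩ := exists_seq_of_forall_finset_exists (fun y : H => ‖y‖ = 1)
    (fun y z : H => KOrth K y z ∧ KOrth K (g y) z ∧ KOrth K (g⁻¹ y) z) (fun s _ => by
      obtain ⟨y, hy, hs⟩ := exists_unit_kOrth (K := K) hinf
        (s ∪ s.image g ∪ s.image (g⁻¹ : UnitaryGroup K H))
      exact ⟨y, hy, fun z hz => ⟨hs z (by simp [hz]),
        hs _ (Finset.mem_union_left _ (Finset.mem_union_right _ (Finset.mem_image_of_mem _ hz))),
        hs _ (Finset.mem_union_right _ (Finset.mem_image_of_mem _ hz))⟩⟩)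
  refine ⟨x, ⟨hx1, fun m n hmn => ?_⟩, fun m n hmn => ?_⟩
  · rcases hmn.lt_or_gt with h | h
    exacts [(hx m n h).1, (hx n m h).1.symm]
  · rcases hmn.lt_or_gt with h | h
    · rw [kOrth_map_right]
      exact (hx m n h).2.2
    · exact (hx n m h).2.1.symm

/-- In infinite dimension, a rich normal subgroup is everything. -/
theorem IsRich.eq_top {N : Subgroup (UnitaryGroup K H)} [N.Normal] (hN : IsRich N)
    (hinf : ¬ FiniteDimensional ℝ H) : N = ⊤ := by
  refine (Subgroup.eq_top_iff' N).2 fun g => ?_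
  obtain ⟨x, hx, hxg⟩ := exists_seq_kOrth_map hinf g
  have h2 : Function.Injective fun n : ℕ => 2 * n := fun m n h => by simpa using h
  have h3 : Function.Injective fun n : ℕ => 2 * n + 1 := fun m n h => by simpa using h
  have hef : KOrthonormal K (Sum.elim (fun n => x (2 * n)) (fun n => x (2 * n + 1))) :=
    kOrthonormal_sumElim_iff.2 ⟨hx.comp h2, hx.comp h3, fun i j => hx.orth _ _ (by lia)⟩
  have hfg : KOrthonormal K (Sum.elim (fun n => x (2 * n + 1)) (fun n => g (x (2 * n)))) :=
    kOrthonormal_sumElim_iff.2 ⟨hx.comp h3, (hx.comp h2).map g, fun i j => hxg _ _ (by lia)⟩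
  -- The even and odd terms need not be disjoint from their own images, but the odd terms are
  -- orthogonal to the images of the even ones. Two swaps therefore carry `x (2 * n)` through `x (2
  -- * n + 1)` to `g (x (2 * n))`, and `g` differs from their product by an operator fixing all `x
  -- (2 * n)`.
  obtain ⟨r, hrN, hr, -⟩ := hN.exists_swap hef
  obtain ⟨r', hrN', hr', -⟩ := hN.exists_swap hfg
  have : (r' * r)⁻¹ * g ∈ N := hN.mem_of_fixes hef (h := (r' * r)⁻¹ * g) fun i => by
    rw [mul_apply, ← hr', ← hr, ← mul_apply r', inv_apply_self]
  have h4 := mul_mem (mul_mem hrN' hrN) this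
  rwa [mul_inv_cancel_left] at h4

end Swindle

end HilbertScalars

/-! ### Averaging over commuting isometries -/

section Averaging

open Filter Topology

variable {A V : Type*} [AddCommGroup A] [NormedAddCommGroup V] [InnerProductSpace ℂ V]

/-- If all finite products of commuting isometries `U (a n)` move `v` by at most `ε`, then averaging
produces vectors near `v` that are asymptotically fixed by the isometries. -/
theorem exists_asymptotically_fixed {U : A → V →L[ℂ] V} (hadd : ∀ a b v, U (a + b) v = U a (U b v))
    (hzero : ∀ v, U 0 v = v) (hnorm : ∀ a v, ‖U a v‖ = ‖v‖) (a : ℕ → A) (v : V) {ε : ℝ}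
    (h : ∀ T : Finset ℕ, ‖U (∑ k ∈ T, a k) v - v‖ ≤ ε) :
    ∃ x : ℕ → V, (∀ n, ‖x n - v‖ ≤ ε) ∧
      Tendsto (fun n => ‖U (a n) (x n) - x n‖) atTop (𝓝 0) := by
  let x : ℕ → V := fun n => Nat.rec v (fun n y => (1 / 2 : ℝ) • (y + U (a n) y)) n
  have hx : ∀ n, x (n + 1) = (1 / 2 : ℝ) • (x n + U (a n) (x n)) := fun n => rfl
  -- The bound must be carried along for all products over later indices: the average defining `x (n
  -- + 1)` involves the index set `T` and `insert n T`.
  have key : ∀ n, ∀ T : Finset ℕ, (∀ k ∈ T, n ≤ k) → ‖U (∑ k ∈ T, a k) (x n) - v‖ ≤ ε := by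
    intro n
    induction n with
    | zero => exact fun T _ => h T
    | succ n ih =>
      intro T hT
      have hn : n ∉ T := fun hn => by have := hT n hn; lia
      have h1 := ih T fun k hk => (Nat.le_succ n).trans (hT k hk)
      have h2 := ih (insert n T) fun k hk => by
        rcases Finset.mem_insert.1 hk with rfl | hk
        exacts [le_rfl, (Nat.le_succ n).trans (hT k hk)]
      rw [Finset.sum_insert hn, add_comm, hadd] at h2
      have e : U (∑ k ∈ T, a k) (x (n + 1)) - v = (1 / 2 : ℝ) • ((U (∑ k ∈ T, a k) (x n) - v) +
          (U (∑ k ∈ T, a k) (U (a n) (x n)) - v)) := by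
        rw [hx, ← Complex.coe_smul, map_smul, Complex.coe_smul, map_add]
        module
      rw [e, norm_smul, Real.norm_of_nonneg (by norm_num)]
      linarith [norm_add_le (U (∑ k ∈ T, a k) (x n) - v)
        (U (∑ k ∈ T, a k) (U (a n) (x n)) - v)]
  refine ⟨x, fun n => by simpa [hzero] using key n ∅ (by simp), ?_⟩
  -- By the parallelogram law, the displacement measures the norm lost in averaging; a decreasing
  -- nonnegative sequence has differences tending to `0`.
  have hstep : ∀ n, ‖U (a n) (x n) - x n‖ ^ 2 = 4 * (‖x n‖ ^ 2 - ‖x (n + 1)‖ ^ 2) := fun n => by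
    have h1 := parallelogram_law_with_norm ℂ (U (a n) (x n)) (x n)
    rw [hnorm] at h1
    rw [hx, norm_smul, add_comm (x n), Real.norm_of_nonneg (by norm_num)]
    linarith
  have hanti : Antitone fun n => ‖x n‖ ^ 2 := antitone_nat_of_succ_le fun n => by
    have := hstep n
    nlinarith [sq_nonneg ‖U (a n) (x n) - x n‖]
  have hlim := tendsto_atTop_ciInf hanti ⟨0, by rintro _ ⟨n, rfl⟩; positivity⟩
  have hsq : Tendsto (fun n => ‖U (a n) (x n) - x n‖ ^ 2) atTop (𝓝 0) := by
    simp_rw [hstep]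
    have := (hlim.sub (hlim.comp (tendsto_add_atTop_nat 1))).const_mul 4
    rwa [sub_self, mul_zero] at this
  have := (Real.continuous_sqrt.tendsto 0).comp hsq
  simpa [Function.comp_def, Real.sqrt_sq] using this

theorem norm_apply_sub_le_nsmul {U : A → V →L[ℂ] V}
    (hadd : ∀ a b v, U (a + b) v = U a (U b v))
    (hzero : ∀ v, U 0 v = v) (hnorm : ∀ a v, ‖U a v‖ = ‖v‖) (a : A) (v : V) (m : ℕ) :
    ‖U (m • a) v - v‖ ≤ m * ‖U a v - v‖ := by
  induction m with
  | zero => simp [hzero]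
  | succ m ih =>
    rw [succ_nsmul, hadd]
    calc ‖U (m • a) (U a v) - v‖ = ‖U (m • a) (U a v - v) + (U (m • a) v - v)‖ := by
          rw [map_sub]; congr 1; abel
      _ ≤ ‖U a v - v‖ + m * ‖U a v - v‖ := by
          refine (norm_add_le _ _).trans (add_le_add (hnorm _ _).le ih)
      _ = _ := by push_cast; ring

/-- With `m` fixed, averaging for the roots `U (m⁻¹ • b n)` gives `x n` within `ε / 4` of `v` and
asymptotically fixed by the roots. The `m`-th power `U (b n)` loses only the constant factor `m`, so
it also asymptotically fixes `x n`. -/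
theorem tendsto_norm_apply_sub [Module ℝ A] {U : A → V →L[ℂ] V}
    (hadd : ∀ a b v, U (a + b) v = U a (U b v))
    (hzero : ∀ v, U 0 v = v) (hnorm : ∀ a v, ‖U a v‖ = ‖v‖) (b : ℕ → A) (v : V)
    (h : ∀ ε > 0, ∃ m : ℕ, 0 < m ∧
      ∀ T : Finset ℕ, ‖U (∑ k ∈ T, (m : ℝ)⁻¹ • b k) v - v‖ ≤ ε) :
    Tendsto (fun n => ‖U (b n) v - v‖) atTop (𝓝 0) := by
  rw [Metric.tendsto_atTop]
  intro ε hε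
  obtain ⟨m, hm, hT⟩ := h (ε / 4) (by positivity)
  obtain ⟨x, hxv, hx⟩ := exists_asymptotically_fixed hadd hzero hnorm _ v hT
  obtain ⟨n₀, hn₀⟩ := (Metric.tendsto_atTop.1 (hx.const_mul (m : ℝ))) (ε / 2) (by positivity)
  refine ⟨n₀, fun n hn => ?_⟩
  have h1 := hn₀ n hn
  have h2 := norm_apply_sub_le_nsmul hadd hzero hnorm ((m : ℝ)⁻¹ • b n) (x n) m
  have hm' : (m : ℝ) ≠ 0 := by positivity
  rw [← Nat.cast_smul_eq_nsmul ℝ, smul_smul, mul_inv_cancel₀ hm', one_smul] at h2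
  rw [mul_zero, Real.dist_eq, sub_zero] at h1
  have h1' := (le_abs_self _).trans_lt h1
  rw [Real.dist_eq, sub_zero, abs_of_nonneg (norm_nonneg _)]
  have h3 : U (b n) v - v = (U (b n) (x n) - x n) - U (b n) (x n - v) + (x n - v) := by
    rw [map_sub]; abel
  rw [h3]
  have h4 := norm_add_le ((U (b n) (x n) - x n) - U (b n) (x n - v)) (x n - v)
  have h5 := norm_sub_le (U (b n) (x n) - x n) (U (b n) (x n - v))
  rw [hnorm] at h5
  linarith [hxv n]

end Averaging

/-! ### Almost disjoint sets and separability -/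

section AlmostDisjoint

/-- The graph of `n ↦ ⌊n r⌋`; these sets are pairwise almost disjoint. -/
def floorGraph (r : ℝ) : Set (ℕ × ℤ) := {p | p.2 = ⌊p.1 * r⌋}

/-- A common point over `n` forces `n * |r - s| < 1`. -/
theorem finite_floorGraph_inter {r s : ℝ} (hrs : r ≠ s) :
    (floorGraph r ∩ floorGraph s).Finite := by
  obtain ⟨N, hN⟩ := exists_nat_gt (|r - s|⁻¹)
  have hpos : 0 < |r - s| := abs_pos.2 (sub_ne_zero.2 hrs)
  refine ((Finset.range N).finite_toSet.image fun n : ℕ => (n, ⌊(n : ℝ) * r⌋)).subset ?_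
  rintro ⟨n, k⟩ ⟨hr, hs⟩
  simp only [floorGraph, Set.mem_ofPred_eq] at hr hs
  refine ⟨n, ?_, by rw [hr]⟩
  have h1 := Int.abs_sub_lt_one_of_floor_eq_floor (hr.symm.trans hs)
  rw [← mul_sub, abs_mul, Nat.abs_cast] at h1
  simp only [Finset.coe_range, Set.mem_Iio]
  have h2 : (n : ℝ) < |r - s|⁻¹ := by
    rwa [← one_div, lt_div_iff₀ hpos]
  exact_mod_cast h2.trans hN

theorem infinite_floorGraph (r : ℝ) : Infinite (floorGraph r) :=
  Infinite.of_injective (fun n : ℕ => (⟨(n, ⌊n * r⌋), rfl⟩ : floorGraph r)) fun m n h => by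
    simpa using congrArg (fun p : floorGraph r => p.1.1) h

theorem infinite_floorGraph_compl (r : ℝ) : Infinite ↥(floorGraph r)ᶜ :=
  Infinite.of_injective
    (fun n : ℕ => (⟨(n, ⌊n * r⌋ + 1), by simp [floorGraph]⟩ : ↥(floorGraph r)ᶜ)) fun m n h => by
    simpa using congrArg (fun p : ↥(floorGraph r)ᶜ => p.1.1) h

open Classical Filter Topology

variable {V : Type*} [NormedAddCommGroup V] [InnerProductSpace ℂ V] [SeparableSpace V]

/-- A representation of the group of functions on `ℕ × ℤ` on a separable space, continuous for the
sup norm and killing finitely supported functions, kills the indicator function of an infinite set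
with infinite complement. -/
theorem exists_indicator_acts_trivially {U : (ℕ × ℤ → ℝ) → V →L[ℂ] V}
    (hadd : ∀ a b v, U (a + b) v = U a (U b v))
    (hnorm : ∀ a v, ‖U a v‖ = ‖v‖)
    (hfin : ∀ a, (Function.support a).Finite → ∀ v, U a v = v)
    (hcont : ∀ v, ∀ ε > 0, ∃ δ > 0, ∀ a, (∀ i, |a i| ≤ δ) → ‖U a v - v‖ ≤ ε) (t : ℝ) :
    ∃ r : ℝ, ∀ v, U ((floorGraph r).indicator fun _ => t) v = v := by
  set b : ℝ → ℕ × ℤ → ℝ := fun r => (floorGraph r).indicator fun _ => t with hb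
  have hzero : ∀ v, U 0 v = v := hfin 0 (by simp)
  have htend : ∀ v, ∀ r : ℕ → ℝ, Function.Injective r →
      Tendsto (fun n => ‖U (b (r n)) v - v‖) atTop (𝓝 0) := by
    intro v r hr
    refine tendsto_norm_apply_sub hadd hzero hnorm (fun n => b (r n)) v fun ε hε => ?_
    obtain ⟨δ, hδ, hU⟩ := hcont v ε hε
    obtain ⟨m, hm⟩ := exists_nat_gt (|t| / δ)
    have hm0 : (0 : ℝ) < m := lt_of_le_of_lt (by positivity) hm
    refine ⟨m, by exact_mod_cast hm0, fun T => ?_⟩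
    set a := ∑ k ∈ T, (m : ℝ)⁻¹ • b (r k) with ha
    -- Off the finitely many overlaps, `a` agrees with `a'`, whose sup norm is at most `|t| / m < δ`
    -- however large `T` is.
    set a' : ℕ × ℤ → ℝ := (⋃ k ∈ T, floorGraph (r k)).indicator fun _ => (m : ℝ)⁻¹ * t with ha'
    have h1 : (Function.support (a - a')).Finite := by
      refine (T.finite_toSet.biUnion fun k _ => T.finite_toSet.biUnion fun l _ =>
        (?_ : (if k = l then ∅ else floorGraph (r k) ∩ floorGraph (r l)).Finite)).subset ?_
      · split_ifs with hkl
        exacts [Set.finite_empty, finite_floorGraph_inter (hr.ne hkl)]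
      · intro p hp
        by_contra hcon
        simp only [Set.mem_iUnion, not_exists] at hcon
        refine hp ?_
        simp only [Pi.sub_apply, ha, ha', Finset.sum_apply, Pi.smul_apply, smul_eq_mul, hb]
        by_cases hpT : ∃ k ∈ T, p ∈ floorGraph (r k)
        · obtain ⟨k, hk, hpk⟩ := hpT
          rw [Set.indicator_of_mem (Set.mem_iUnion₂.2 ⟨k, hk, hpk⟩), Finset.sum_eq_single_of_mem k hk,
            Set.indicator_of_mem hpk, sub_self]
          intro l hl hlk
          have := hcon k hk l hl
          rw [if_neg hlk.symm] at this
          rw [Set.indicator_of_notMem fun h => this ⟨hpk, h⟩, mul_zero]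
        · push Not at hpT
          rw [Set.indicator_of_notMem (by simpa using hpT), Finset.sum_eq_zero, sub_zero]
          intro l hl
          rw [Set.indicator_of_notMem (hpT l hl), mul_zero]
    have h2 : U a v = U a' v := by
      rw [← sub_add_cancel a a', hadd, hfin _ h1]
    rw [h2]
    refine hU a' fun p => ?_
    by_cases hp : p ∈ ⋃ k ∈ T, floorGraph (r k)
    · rw [ha', Set.indicator_of_mem hp, abs_mul, abs_inv, Nat.abs_cast, inv_mul_le_iff₀ hm0]
      rw [div_lt_iff₀ hδ] at hm
      exact hm.le
    · rw [ha', Set.indicator_of_notMem hp, abs_zero]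
      exact hδ.le
  -- An infinite set of parameters displacing `v` by more than a fixed amount would contain an
  -- injective sequence contradicting `htend`. A countable dense set of vectors then excludes only
  -- countably many real parameters.
  have hcount : ∀ v, {r | U (b r) v ≠ v}.Countable := fun v => by
    have hsub : {r | U (b r) v ≠ v} ⊆ ⋃ n : ℕ, {r | 1 / ((n : ℝ) + 1) < ‖U (b r) v - v‖} :=
      fun r hr => by
        obtain ⟨n, hn⟩ := exists_nat_one_div_lt (norm_pos_iff.2 (sub_ne_zero.2 hr))
        exact Set.mem_iUnion.2 ⟨n, hn⟩
    refine (Set.countable_iUnion fun n => Set.Finite.countable ?_).mono hsub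
    by_contra hinf
    let φ := Set.Infinite.natEmbedding _ hinf
    have h1 := htend v (fun n => φ n) fun m n h => φ.injective (Subtype.ext h)
    have h2 : 1 / ((n : ℝ) + 1) ≤ 0 := ge_of_tendsto' h1 fun k => le_of_lt (φ k).2
    have : 0 < 1 / ((n : ℝ) + 1) := by positivity
    linarith
  have hc : (⋃ n, {r | U (b r) (denseSeq V n) ≠ denseSeq V n}).Countable :=
    Set.countable_iUnion fun n => hcount _
  obtain ⟨r, hr⟩ : ∃ r, r ∉ ⋃ n, {r | U (b r) (denseSeq V n) ≠ denseSeq V n} := by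
    by_contra! hall
    exact Set.not_countable_univ (α := ℝ) (hc.mono fun r _ => hall r)
  refine ⟨r, fun v => ?_⟩
  have := Continuous.ext_on (denseRange_denseSeq V) (U (b r)).continuous continuous_id (by
    rintro _ ⟨n, rfl⟩
    by_contra hne
    exact hr (Set.mem_iUnion.2 ⟨n, hne⟩))
  exact congrFun this v

end AlmostDisjoint

namespace HilbertScalars

variable {K H ι κ : Type*} [Ring K] [Algebra ℝ K] [NormedAddCommGroup H]
  [InnerProductSpace ℝ H] [Module K H] [IsScalarTower ℝ K H] [HilbertScalars K H]

/-! ### Compact perturbations and the identity component -/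

section Compact

theorem exists_finiteDimensional_smul_mem (K : Type*) [Ring K] [Algebra ℝ K] [Module K H]
    [IsScalarTower ℝ K H] [HilbertScalars K H] {s : Set H} (hs : s.Finite) :
    ∃ F : Submodule ℝ H, FiniteDimensional ℝ F ∧ ∀ x ∈ s, ∀ k : K, k • x ∈ F := by
  obtain ⟨n, β, hspan, -⟩ := exists_frame (K := K) (H := H)
  refine ⟨Submodule.span ℝ (Set.image2 (fun m x => β m • x) Set.univ s),
    FiniteDimensional.span_of_finite ℝ (Set.finite_univ.image2 _ hs), fun x hx k => ?_⟩
  obtain ⟨c, rfl⟩ := hspan k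
  simp only [Finset.sum_smul, smul_assoc]
  exact Submodule.sum_mem _ fun m _ => Submodule.smul_mem _ _
    (Submodule.subset_span ⟨m, trivial, x, hx, rfl⟩)

theorem isCompactOperator_of_finiteDimensional_range {T : H →L[ℝ] H} {F : Submodule ℝ H}
    [FiniteDimensional ℝ F] (hT : ∀ x, T x ∈ F) : IsCompactOperator T := by
  have := FiniteDimensional.proper_real F
  have h1 : IsCompactOperator (T.codRestrict F hT) :=
    isCompactOperator_of_locallyCompactSpace_dom _
  exact h1.clm_comp F.subtypeL

/-- A unitary operator which moves only finitely many basis vectors is a compact perturbation of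
the identity. -/
theorem IsKBasis.mem_compactPerturbations [CompleteSpace H] {b : ι → H} (hb : IsKBasis K b)
    {g : UnitaryGroup K H} {s : Set ι} (hs : s.Finite) (hg : ∀ i ∉ s, g (b i) = b i) :
    g ∈ UnitaryGroup.compactPerturbations K H := by
  obtain ⟨F, hF, hmem⟩ := exists_finiteDimensional_smul_mem K
    (hs.image fun i => g (b i) - b i)
  refine isCompactOperator_of_finiteDimensional_range (F := F) ?_
  refine hb.mem_of_isClosed
    (F.comap ((UnitaryGroup.toCLM g - 1 : H →L[ℝ] H) : H →ₗ[ℝ] H))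
    (F.closed_of_finiteDimensional.preimage
      (UnitaryGroup.toCLM g - 1 : H →L[ℝ] H).continuous) fun i k => ?_
  change g (k • b i) - k • b i ∈ F
  rw [map_smul, ← smul_sub]
  by_cases hi : i ∈ s
  · exact hmem _ ⟨i, hi, rfl⟩ k
  · rw [hg i hi, sub_self, smul_zero]
    exact F.zero_mem

theorem mem_compactPerturbationsZero {X : Type*} [TopologicalSpace X] [PreconnectedSpace X]
    {γ : X → UnitaryGroup K H} (hγ : Continuous γ)
    (hmem : ∀ t, γ t ∈ UnitaryGroup.compactPerturbations K H) {s : X} (hs : γ s = 1) (t : X) :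
    γ t ∈ UnitaryGroup.compactPerturbationsZero K H := by
  refine ⟨⟨γ t, hmem t⟩, ?_, rfl⟩
  have hc : Continuous fun t => (⟨γ t, hmem t⟩ : UnitaryGroup.compactPerturbations K H) :=
    hγ.subtype_mk _
  refine (isPreconnected_range hc).subset_connectedComponent ?_ ⟨t, rfl⟩
  exact ⟨s, Subtype.ext hs⟩

end Compact

/-! ### The rotation operators -/

section Rotation

variable [CompleteSpace H]

/-- The rotations by the angles `θ i` in the planes spanned by `e i` and `f i`. -/
noncomputable def rotation {e f : ι → H} (h : IsKBasis K (Sum.elim e f)) (θ : ι → ℝ) :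
    UnitaryGroup K H :=
  (h.exists_unitary (h.rotate (c := fun i => Real.cos (θ i)) (s := fun i => Real.sin (θ i))
    fun _ => Real.cos_sq_add_sin_sq _)).choose

variable {e f : ι → H} (h : IsKBasis K (Sum.elim e f))

theorem rotation_apply_left (θ : ι → ℝ) (i : ι) :
    rotation h θ (e i) = Real.cos (θ i) • e i + Real.sin (θ i) • f i :=
  (h.exists_unitary (h.rotate (c := fun i => Real.cos (θ i)) (s := fun i => Real.sin (θ i))
    fun _ => Real.cos_sq_add_sin_sq _)).choose_spec (.inl i)

theorem rotation_apply_right (θ : ι → ℝ) (i : ι) :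
    rotation h θ (f i) = Real.cos (θ i) • f i - Real.sin (θ i) • e i :=
  (h.exists_unitary (h.rotate (c := fun i => Real.cos (θ i)) (s := fun i => Real.sin (θ i))
    fun _ => Real.cos_sq_add_sin_sq _)).choose_spec (.inr i)

theorem rotation_add (θ θ' : ι → ℝ) : rotation h (θ + θ') = rotation h θ * rotation h θ' := by
  refine h.unitary_ext ?_
  rintro (i | i)
  · simp only [Sum.elim_inl, mul_apply, rotation_apply_left, map_add, map_real_smul,
      rotation_apply_right, Pi.add_apply, Real.cos_add, Real.sin_add]
    module
  · simp only [Sum.elim_inr, mul_apply, rotation_apply_left, map_sub, map_real_smul,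
      rotation_apply_right, Pi.add_apply, Real.cos_add, Real.sin_add]
    module

theorem rotation_zero : rotation h 0 = 1 := by
  have := rotation_add h 0 0
  rw [add_zero] at this
  exact left_eq_mul.1 this

theorem rotation_neg (θ : ι → ℝ) : rotation h (-θ) = (rotation h θ)⁻¹ :=
  eq_inv_of_mul_eq_one_left (by rw [← rotation_add, neg_add_cancel, rotation_zero])

/-- For the rotation `R`, unitarity gives `‖R x - x‖² = ⟪(2 - R - R⁻¹) x, x⟫`. The operator `R +
R⁻¹` is diagonal with entries `2 cos (θ i)`, and `2 - 2 cos t ≤ t²`. -/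
theorem norm_rotation_sub_le {θ : ι → ℝ} {δ : ℝ} (hδ : 0 ≤ δ) (hθ : ∀ i, |θ i| ≤ δ) (x : H) :
    ‖rotation h θ x - x‖ ≤ δ * ‖x‖ := by
  obtain ⟨n, β, hspan, hβ⟩ := exists_frame (K := K) (H := H)
  obtain ⟨B, hB⟩ := h.exists_hilbertBasis hspan hβ
  set c : (ι ⊕ ι) × Fin n → ℝ := fun p => Real.cos (Sum.elim θ θ p.1) with hc
  have hcos : ∀ p, rotation h θ (B p) + rotation h (-θ) (B p) = (2 * c p) • B p := by
    rintro ⟨i | i, m⟩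
    · simp only [hB, hc, Sum.elim_inl, map_smul, rotation_apply_left, Pi.neg_apply, Real.cos_neg,
        Real.sin_neg, ← smul_add, ← smul_real_smul]
      congr 1
      module
    · simp only [hB, hc, Sum.elim_inr, map_smul, rotation_apply_right, Pi.neg_apply, Real.cos_neg,
        Real.sin_neg, ← smul_add, ← smul_real_smul]
      congr 1
      module
  have h1 : ‖rotation h θ x - x‖ ^ 2 =
      2 * ‖x‖ ^ 2 - ⟪rotation h θ x + rotation h (-θ) x, x⟫_ℝ := by
    rw [norm_sub_sq_real, LinearIsometryEquiv.norm_map, inner_add_left, rotation_neg,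
      inner_map_left (rotation h θ)⁻¹, inv_inv, real_inner_comm (rotation h θ x)]
    ring
  have h2 : HasSum (fun p => 2 * c p * ⟪B p, x⟫_ℝ ^ 2)
      ⟪rotation h θ x + rotation h (-θ) x, x⟫_ℝ := by
    have hs := B.hasSum_inner_mul_inner (rotation h θ x + rotation h (-θ) x) x
    refine (congrArg (fun F => HasSum F _) (funext fun p => ?_)).mpr hs
    have : ⟪rotation h θ x + rotation h (-θ) x, B p⟫_ℝ = 2 * c p * ⟪B p, x⟫_ℝ := by
      rw [inner_add_left, inner_map_left, inner_map_left, ← rotation_neg, ← rotation_neg, neg_neg,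
        ← inner_add_right, add_comm, hcos, real_inner_smul_right, real_inner_comm]
    rw [this]; ring
  have h3 : HasSum (fun p => ⟪B p, x⟫_ℝ ^ 2) (‖x‖ ^ 2) := by
    rw [← real_inner_self_eq_norm_sq]
    have hs := B.hasSum_inner_mul_inner x x
    refine (congrArg (fun F => HasSum F _) (funext fun p => ?_)).mpr hs
    rw [real_inner_comm, sq]
  have h4 : ‖rotation h θ x - x‖ ^ 2 ≤ δ ^ 2 * ‖x‖ ^ 2 := by
    rw [h1]
    refine hasSum_le (fun p => ?_) ((h3.mul_left 2).sub h2) (h3.mul_left (δ ^ 2))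
    have h5 : (Sum.elim θ θ p.1) ^ 2 ≤ δ ^ 2 := by
      rw [← sq_abs]
      rcases p with ⟨i | i, m⟩ <;> exact pow_le_pow_left₀ (abs_nonneg _) (hθ i) 2
    have h6 := Real.one_sub_sq_div_two_le_cos (x := Sum.elim θ θ p.1)
    have h7 : 2 - 2 * c p ≤ δ ^ 2 := by linarith
    have h8 := mul_le_mul_of_nonneg_right h7 (sq_nonneg ⟪B p, x⟫_ℝ)
    linarith
  rw [← mul_pow] at h4
  exact (pow_le_pow_iff_left₀ (norm_nonneg _) (by positivity) two_ne_zero).1 h4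

theorem norm_toCLM_rotation_sub_le {θ θ' : ι → ℝ} {δ : ℝ} (hδ : 0 ≤ δ)
    (hθ : ∀ i, |θ i - θ' i| ≤ δ) :
    ‖UnitaryGroup.toCLM (rotation h θ) - UnitaryGroup.toCLM (rotation h θ')‖ ≤ δ := by
  refine ContinuousLinearMap.opNorm_le_bound _ hδ fun x => ?_
  have : rotation h θ = rotation h (θ - θ') * rotation h θ' := by
    rw [← rotation_add, sub_add_cancel]
  rw [this]
  have := norm_rotation_sub_le h (θ := θ - θ') hδ hθ (rotation h θ' x)
  rwa [LinearIsometryEquiv.norm_map] at this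

/-- The path `t ↦ rotation h (t • θ)` starts at `1`, is Lipschitz because `θ` is bounded, and moves
only finitely many basis vectors. -/
theorem rotation_mem_compactPerturbationsZero {θ : ι → ℝ} (hθ : (Function.support θ).Finite) :
    rotation h θ ∈ UnitaryGroup.compactPerturbationsZero K H := by
  obtain ⟨M, hM⟩ : ∃ M : ℝ, ∀ i, |θ i| ≤ M := by
    obtain ⟨M, hM⟩ := (hθ.image fun i => |θ i|).bddAbove
    refine ⟨max M 0, fun i => ?_⟩
    by_cases hi : θ i = 0
    · simp [hi]
    · exact (hM ⟨i, hi, rfl⟩).trans (le_max_left _ _)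
  have hcont : Continuous fun t : ℝ => rotation h (t • θ) := by
    refine continuous_induced_rng.2 ?_
    refine (LipschitzWith.of_dist_le_mul (K := M.toNNReal) fun t s => ?_).continuous
    rw [dist_eq_norm]
    refine norm_toCLM_rotation_sub_le h (by positivity) fun i => ?_
    rw [Pi.smul_apply, Pi.smul_apply, ← sub_smul, smul_eq_mul, abs_mul, mul_comm, Real.dist_eq]
    exact mul_le_mul_of_nonneg_right ((hM i).trans (Real.le_coe_toNNReal M)) (abs_nonneg _)
  have := mem_compactPerturbationsZero hcont (fun t => ?_) (s := 0)
    (by rw [zero_smul, rotation_zero]) 1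
  · rwa [one_smul] at this
  · refine h.mem_compactPerturbations (s := Sum.inl '' Function.support θ ∪
      Sum.inr '' Function.support θ) ((hθ.image _).union (hθ.image _)) ?_
    rintro (i | i) hi
    · have : θ i = 0 := by simpa using hi
      simp [rotation_apply_left, this]
    · have : θ i = 0 := by simpa using hi
      simp [rotation_apply_right, this]

theorem rotation_indicator_pi_isReflection (A : Set ι) :
    IsReflection K (rotation h (A.indicator fun _ => Real.pi))
      (Sum.elim (fun i : A => e i) (fun i : A => f i)) := by
  have hneg : ∀ i ∈ A, A.indicator (fun _ => Real.pi) i = Real.pi := fun i hi =>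
    Set.indicator_of_mem hi _
  refine ⟨?_, fun x hx => ?_⟩
  · rintro (i | i)
    · simp [rotation_apply_left]
    · simp [rotation_apply_right]
  · rw [← sub_eq_zero]
    refine h.complete _ ?_
    set g := rotation h (A.indicator fun _ => Real.pi) with hg
    have hfix : ∀ y, g y = y → KOrth K y (g x - x) := fun y hy k => by
      have : ⟪k • y, g x⟫_ℝ = ⟪k • y, x⟫_ℝ := by
        conv_lhs => rw [← hy, ← map_smul, inner_map_map]
      rw [inner_sub_right, this, sub_self]
    have hflip : ∀ y, g y = -y → KOrth K y x → KOrth K y (g x - x) := fun y hy hyx =>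
      KOrth.sub_right (fun k => by
        have : k • y = g (k • -y) := by rw [map_smul, map_neg, hy, neg_neg]
        rw [this, inner_map_map, smul_neg, inner_neg_left, hyx k, neg_zero]) hyx
    rintro (i | i) <;> by_cases hi : i ∈ A
    · exact hflip _ (by simp [hg, rotation_apply_left, hneg i hi]) (hx (.inl ⟨i, hi⟩))
    · exact hfix _ (by simp [hg, rotation_apply_left, hi])
    · exact hflip _ (by simp [hg, rotation_apply_right, hneg i hi]) (hx (.inr ⟨i, hi⟩))
    · exact hfix _ (by simp [hg, rotation_apply_right, hi])

end Rotation

/-! ### The theorem in infinite dimension -/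

section InfiniteDimensional

variable [CompleteSpace H] [SeparableSpace H]

theorem exists_isKBasis_sum (hinf : ¬ FiniteDimensional ℝ H) [Countable ι] [Infinite ι] :
    ∃ e f : ι → H, IsKBasis K (Sum.elim e f) := by
  obtain ⟨x, hx, -⟩ := exists_seq_kOrth_map hinf (1 : UnitaryGroup K H)
  -- Completing the empty family, with `x` witnessing an infinite complement, gives a countably
  -- infinite basis, which is then reindexed by two copies of `ι`.
  have h1 : KOrthonormal K (Sum.elim (Empty.elim : Empty → H) x) :=
    kOrthonormal_sumElim_iff.2 ⟨⟨fun i => i.elim, fun i => i.elim⟩, hx, fun i => i.elim⟩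
  obtain ⟨b, hb⟩ := h1.exists_complement
  obtain ⟨φ⟩ := nonempty_equiv_of_countable (α := ι ⊕ ι) (β := Empty ⊕ ℕ)
  have h2 := hb.comp_equiv φ
  rw [← Sum.elim_comp_inl_inr (Sum.elim Empty.elim b ∘ φ)] at h2
  exact ⟨_, _, h2⟩

/-- Pickrell's theorem in infinite dimension. -/
theorem isTrivial_of_infinite (hinf : ¬ FiniteDimensional ℝ H) {V : Type*} [NormedAddCommGroup V]
    [InnerProductSpace ℂ V] [CompleteSpace V] [SeparableSpace V]
    (π : ContinuousUnitaryRep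
      (UnitaryGroup K H ⧸ UnitaryGroup.compactPerturbationsZero K H) V) : π.IsTrivial := by
  let ρ : UnitaryGroup K H →* unitary (V →L[ℂ] V) :=
    π.toHom.comp (QuotientGroup.mk' (UnitaryGroup.compactPerturbationsZero K H))
  have hρcont : ∀ v, Continuous fun g => (ρ g : V →L[ℂ] V) v := fun v =>
    (π.continuous_orbit v).comp continuous_quotient_mk'
  have hρker : ∀ g ∈ UnitaryGroup.compactPerturbationsZero K H, ρ g = 1 := fun g hg => by
    change π.toHom (QuotientGroup.mk' _ g) = 1
    rw [QuotientGroup.mk'_apply, (QuotientGroup.eq_one_iff g).2 hg, map_one]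
  obtain ⟨e, f, h⟩ := exists_isKBasis_sum (K := K) (ι := ℕ × ℤ) hinf
  let U : (ℕ × ℤ → ℝ) → V →L[ℂ] V := fun θ => (ρ (rotation h θ) : V →L[ℂ] V)
  have hcont : ∀ v, ∀ ε > 0, ∃ δ > 0, ∀ a : ℕ × ℤ → ℝ, (∀ i, |a i| ≤ δ) →
      ‖U a v - v‖ ≤ ε := fun v ε hε => by
    have hv := (hρcont v).continuousAt (x := 1)
    obtain ⟨W, hW, hWv⟩ := mem_nhds_induced _ _ _ |>.1 (hv (Metric.closedBall_mem_nhds _ hε))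
    obtain ⟨δ, hδ, hδW⟩ := Metric.mem_nhds_iff.1 hW
    refine ⟨δ / 2, by positivity, fun a ha => ?_⟩
    have h1 : rotation h a ∈ (fun g => UnitaryGroup.toCLM g) ⁻¹' W := hδW (by
      rw [Metric.mem_ball, dist_eq_norm, ← rotation_zero h]
      refine (norm_toCLM_rotation_sub_le h (δ := δ / 2) (by positivity) fun i => ?_).trans_lt
        (by linarith)
      simpa using ha i)
    have h2 := hWv h1
    simpa [dist_eq_norm] using h2
  obtain ⟨r, hr⟩ := exists_indicator_acts_trivially (U := U)
    (fun a b v => by simp [U, rotation_add])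
    (fun a v => by
      simpa using ContinuousLinearMap.norm_map_of_mem_unitary (ρ (rotation h a)).2 v)
    (fun a ha v => by
      simp [U, hρker _ (rotation_mem_compactPerturbationsZero h ha)]) hcont Real.pi
  have := infinite_floorGraph r
  have := infinite_floorGraph_compl r
  -- The trivially acting rotation by `π` is `-1` on the planes over `floorGraph r`; the vectors `e
  -- i` over the infinite complement show that its fixed space is infinite dimensional too.
  have hrich : IsRich ρ.ker := by
    have horth : KOrthonormal K (Sum.elim
        (Sum.elim (fun i : floorGraph r => e i) (fun i : floorGraph r => f i))
        (fun i : ↥(floorGraph r)ᶜ => e i)) := by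
      have := h.toKOrthonormal.comp (f := Sum.elim
        (Sum.map (Subtype.val : floorGraph r → ℕ × ℤ) (Subtype.val : floorGraph r → ℕ × ℤ))
        (fun i : ↥(floorGraph r)ᶜ => Sum.inl i.1)) (by
          rintro ((i | i) | i) ((j | j) | j) hij <;>
            simp only [Sum.elim_inl, Sum.elim_inr, Sum.map_inl, Sum.map_inr, Sum.inl.injEq,
              Sum.inr.injEq, reduceCtorEq] at hij
          · rw [Subtype.ext hij]
          · exact absurd i.2 (hij ▸ j.2)
          · rw [Subtype.ext hij]
          · exact absurd j.2 (hij ▸ i.2)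
          · rw [Subtype.ext hij])
      rw [Sum.comp_elim, Sum.elim_comp_map] at this
      exact this
    refine isRich_of_mem horth (rotation_indicator_pi_isReflection h (floorGraph r)) ?_
    refine MonoidHom.mem_ker.2 (Subtype.ext (ContinuousLinearMap.ext fun v => ?_))
    simpa using hr v
  have htop := hrich.eq_top hinf
  intro g v
  obtain ⟨g, rfl⟩ := QuotientGroup.mk_surjective g
  have : ρ g = 1 := MonoidHom.mem_ker.1 (htop ▸ Subgroup.mem_top g)
  change (ρ g : V →L[ℂ] V) v = v
  rw [this]; rfl

end InfiniteDimensional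

end HilbertScalars

namespace HilbertScalars

variable {K H ι κ : Type*} [Ring K] [Algebra ℝ K] [NormedAddCommGroup H]
  [InnerProductSpace ℝ H] [Module K H] [IsScalarTower ℝ K H] [HilbertScalars K H]

/-! ### Connectedness of the unitary group in finite dimension -/

section FiniteDimensional

variable (K H) in
/-- Nonzero scalars are invertible and the isometric scalars are path connected. -/
structure HasConnectedUnits : Prop where
  exists_inv : ∀ k : K, k ≠ 0 → ∃ k' : K, k * k' = 1 ∧ k' * k = 1
  exists_path : ∀ (d : H), ‖d‖ = 1 → ∀ q : K, ‖q • d‖ = 1 → ∃ γ : unitInterval → K,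
    γ 0 = 1 ∧ γ 1 = q ∧ (∀ t, ‖γ t • d‖ = 1) ∧ ∀ x : H, Continuous fun t => γ t • x

variable [CompleteSpace H]

/-- Multiplying one member of a basis by an isometric scalar gives a basis. -/
theorem IsKBasis.update [DecidableEq ι] (hK : HasConnectedUnits K H) {b : ι → H}
    (hb : IsKBasis K b) (j : ι)
    {q : K} (hq : ‖q • b j‖ = 1) : IsKBasis K (Function.update b j (q • b j)) := by
  refine ⟨⟨fun i => ?_, fun i l hil => ?_⟩, fun x hx => hb.complete x fun i => ?_⟩
  · by_cases hi : i = j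
    · subst hi; simpa using hq
    · simpa [hi] using hb.norm_eq i
  · by_cases hi : i = j
    · subst hi
      simpa [hil.symm] using (hb.orth i l hil).smul_left q
    · by_cases hl : l = j
      · subst hl
        simpa [hi] using (hb.orth i l hil).smul_right q
      · simpa [hi, hl] using hb.orth i l hil
  · by_cases hi : i = j
    · subst hi
      have hq0 : q ≠ 0 := by
        rintro rfl
        simp at hq
      obtain ⟨q', -, hq'⟩ := hK.exists_inv q hq0
      have := (hx i).smul_left q'
      simpa [smul_smul, hq'] using this
    · simpa [hi] using hx i

variable [FiniteDimensional ℝ H]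

theorem mem_compactPerturbations_of_finiteDimensional (g : UnitaryGroup K H) :
    g ∈ UnitaryGroup.compactPerturbations K H := by
  have := FiniteDimensional.proper_real H
  exact isCompactOperator_of_locallyCompactSpace_dom _

/-- The operator multiplying one member of a basis by an isometric scalar lies in the identity
component. -/
theorem IsKBasis.mem_compactPerturbationsZero (hK : HasConnectedUnits K H) {b : ι → H}
    (hb : IsKBasis K b) {j : ι} {q : K} (hq : ‖q • b j‖ = 1) {g : UnitaryGroup K H}
    (hj : g (b j) = q • b j) (hg : ∀ i ≠ j, g (b i) = b i) :
    g ∈ UnitaryGroup.compactPerturbationsZero K H := by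
  classical
  obtain ⟨γ, hγ0, hγ1, hγ, hcont⟩ := hK.exists_path (b j) (hb.norm_eq j) q hq
  choose G hG using fun t => hb.exists_unitary (hb.update hK j (hγ t))
  have hGc : Continuous G := by
    -- In finite dimension norm continuity is pointwise continuity, and the vectors with continuous
    -- orbit form a subspace, automatically closed. So basis vectors suffice.
    refine continuous_induced_rng.2 (continuous_clm_apply.2 ?_)
    let M : Submodule ℝ H :=
      { carrier := {x | Continuous fun t => G t x}
        add_mem' := fun {x y} hx hy => by
          simp only [Set.mem_ofPred_eq, map_add] at hx hy ⊢
          exact hx.add hy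
        zero_mem' := by simpa only [Set.mem_ofPred_eq, map_zero] using continuous_const
        smul_mem' := fun r x hx => by
          simp only [Set.mem_ofPred_eq, map_real_smul] at hx ⊢
          exact hx.const_smul r }
    refine hb.mem_of_isClosed M M.closed_of_finiteDimensional fun i k => ?_
    change Continuous fun t => G t (k • b i)
    simp only [map_smul, hG]
    by_cases hi : i = j
    · subst hi
      simp only [Function.update_self]
      exact (smulCLM H k).continuous.comp (hcont (b i))
    · simpa [hi] using continuous_const
  have h0 : G 0 = 1 := hb.unitary_ext fun i => by
    rw [hG, hγ0, one_smul, Function.update_eq_self, one_apply]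
  have h1 : G 1 = g := hb.unitary_ext fun i => by
    rw [hG, hγ1]
    by_cases hi : i = j
    · subst hi; simp [hj]
    · simp [hi, hg i hi]
  rw [← h1]
  exact HilbertScalars.mem_compactPerturbationsZero hGc
    (fun t => mem_compactPerturbations_of_finiteDimensional _) h0 1

/-- Quasi-reflections lie in the identity component. -/
theorem exists_quasiReflection (hK : HasConnectedUnits K H) {d : H} (hd : ‖d‖ = 1) {q : K}
    (hq : ‖q • d‖ = 1) : ∃ g ∈ UnitaryGroup.compactPerturbationsZero K H,
      g d = q • d ∧ ∀ x, KOrth K d x → g x = x := by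
  classical
  obtain ⟨s, hs, hb⟩ := exists_isKBasis_extension (K := K) (t := {d})
    ⟨by rintro ⟨_, rfl⟩; exact hd, by
      rintro ⟨_, rfl⟩ ⟨_, rfl⟩ h
      exact absurd rfl h⟩
  let j : s := ⟨d, hs rfl⟩
  obtain ⟨g, hg⟩ := hb.exists_unitary (hb.update hK j (q := q) hq)
  have hgd : g d = q • d := by simpa [j] using hg j
  have hgi : ∀ i ≠ j, g i = i := fun i hi => by simpa [hi] using hg i
  refine ⟨g, hb.mem_compactPerturbationsZero hK (j := j) hq hgd hgi, hgd, fun x hx => ?_⟩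
  rw [← sub_eq_zero]
  refine hb.complete _ fun i => ?_
  by_cases hi : i = j
  · subst hi
    refine KOrth.sub_right ?_ hx
    have hq0 : q ≠ 0 := by
      rintro rfl
      simp at hq
    obtain ⟨q', -, hq'⟩ := hK.exists_inv q hq0
    have h1 : d = g (q' • d) := by rw [map_smul, hgd, smul_smul, hq', one_smul]
    change KOrth K d (g x)
    rw [h1]
    exact (hx.smul_left q').map g
  · intro k
    have : ⟪k • (i : H), g x⟫_ℝ = ⟪k • (i : H), x⟫_ℝ := by
      conv_lhs => rw [← hgi i hi, ← map_smul, inner_map_map]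
    rw [inner_sub_right, this, sub_self]

omit [CompleteSpace H] [FiniteDimensional ℝ H] in
-- The vectors `β m • d` are a real orthonormal basis of the `K`-line of `d`, so the coefficient `k`
-- is read off from real inner products.
theorem exists_sub_smul_kOrth {d : H} (hd : ‖d‖ = 1) (x : H) :
    ∃ k : K, KOrth K d (x - k • d) := by
  obtain ⟨n, β, hspan, hβ⟩ := exists_frame (K := K) (H := H)
  refine ⟨∑ m, ⟪β m • d, x⟫_ℝ • β m, fun l => ?_⟩
  obtain ⟨c, rfl⟩ := hspan l
  simp only [Finset.sum_smul, smul_assoc, sum_inner, real_inner_smul_left]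
  refine Finset.sum_eq_zero fun m _ => ?_
  rw [inner_sub_right, inner_sum, Finset.sum_eq_single m]
  · rw [real_inner_smul_right, hβ, if_pos rfl, hd]; simp
  · intro l _ hl
    rw [real_inner_smul_right, hβ, if_neg hl.symm, mul_zero]
  · simp

/-- The identity component acts transitively on unit vectors, by operators that fix the orthogonal
complement. -/
theorem exists_mem_compactPerturbationsZero_map_eq (hK : HasConnectedUnits K H) {u w : H}
    (hu : ‖u‖ = 1) (hw : ‖w‖ = 1) : ∃ g ∈ UnitaryGroup.compactPerturbationsZero K H,
      g u = w ∧ ∀ x, KOrth K u x → KOrth K w x → g x = x := by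
  by_cases huw : u = w
  · exact ⟨1, one_mem _, huw, fun _ _ _ => rfl⟩
  set c : ℝ := ‖w - u‖ with hc
  have hc0 : 0 < c := norm_pos_iff.2 (sub_ne_zero.2 (Ne.symm huw))
  set d : H := c⁻¹ • (w - u) with hdd
  have hd : ‖d‖ = 1 := by
    rw [hdd, norm_smul, norm_inv, Real.norm_of_nonneg hc0.le, ← hc, inv_mul_cancel₀ hc0.ne']
  -- Since `w - u = c • d`, the vectors `u` and `w` share the component `z` orthogonal to the
  -- `K`-line of `d`. Their components `k • d` and `(k + c) • d` have equal norms, so an isometric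
  -- scalar on that line relates them.
  obtain ⟨k, hk⟩ := exists_sub_smul_kOrth (K := K) hd u
  set z := u - k • d with hz
  have hu' : u = k • d + z := by rw [hz]; abel
  have hw' : w = (k + algebraMap ℝ K c) • d + z := by
    have : c • d = w - u := by rw [hdd, smul_smul, mul_inv_cancel₀ hc0.ne', one_smul]
    rw [add_smul, algebraMap_smul, this, hz]
    abel
  have hnu : ‖k • d‖ ^ 2 + ‖z‖ ^ 2 = 1 := by
    have := norm_add_sq_real (k • d) z
    rw [hk k, ← hu', hu] at this
    linarith
  have hnw : ‖(k + algebraMap ℝ K c) • d‖ ^ 2 + ‖z‖ ^ 2 = 1 := by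
    have := norm_add_sq_real ((k + algebraMap ℝ K c) • d) z
    rw [hk, ← hw', hw] at this
    linarith
  have heq : ‖(k + algebraMap ℝ K c) • d‖ = ‖k • d‖ :=
    (sq_eq_sq₀ (norm_nonneg _) (norm_nonneg _)).1 (by linarith)
  have hk0 : k ≠ 0 := by
    rintro rfl
    rw [zero_add, algebraMap_smul, zero_smul, norm_zero, norm_smul, hd,
      Real.norm_of_nonneg hc0.le] at heq
    linarith
  obtain ⟨k', hkk', -⟩ := hK.exists_inv k hk0
  obtain ⟨a, ha0, ha⟩ := exists_norm_smul H k
  -- The factor `q` stands on the right because `g (k • d) = k • g d = (k * q) • d`.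
  obtain ⟨q, hq⟩ : ∃ q : K, k * q = k + algebraMap ℝ K c :=
    ⟨k' * (k + algebraMap ℝ K c), by rw [← mul_assoc, hkk', one_mul]⟩
  have ha1 : a ≠ 0 := by
    rintro rfl
    have := ha (k' • d)
    rw [smul_smul, hkk', one_smul, hd, zero_mul] at this
    exact one_ne_zero this
  have hqd : ‖q • d‖ = 1 := by
    have h1 := ha (q • d)
    rw [smul_smul, hq, heq, ha, hd] at h1
    exact mul_left_cancel₀ ha1 h1.symm
  obtain ⟨g, hg, hgd, hgx⟩ := exists_quasiReflection hK hd hqd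
  refine ⟨g, hg, ?_, fun x hxu hxw => hgx x ((hxw.sub_left hxu).real_smul_left _)⟩
  rw [hw', hu', map_add, map_smul, hgd, hgx z hk, smul_smul, hq]

/-- In finite dimension, the unitary group is connected when the isometric scalars are. -/
theorem compactPerturbationsZero_eq_top (hK : HasConnectedUnits K H) (g : UnitaryGroup K H) :
    g ∈ UnitaryGroup.compactPerturbationsZero K H := by
  classical
  obtain ⟨s, -, hb⟩ := exists_isKBasis_extension (K := K) (H := H) (t := ∅)
    ⟨fun i => i.2.elim, fun i => i.2.elim⟩
  have hfin : Finite s := hb.orthonormal.linearIndependent.finite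
  have := Fintype.ofFinite s
  -- The operator `g` is undone one basis vector at a time. The new factor moves `h (g j)` to `j`
  -- and fixes every treated `i`, which is orthogonal to both.
  have key : ∀ t : Finset s, ∃ h ∈ UnitaryGroup.compactPerturbationsZero K H,
      ∀ i ∈ t, h (g i) = i := fun t => by
    induction t using Finset.induction_on with
    | empty => exact ⟨1, one_mem _, by simp⟩
    | insert j t hj ih =>
      obtain ⟨h, hh, hi⟩ := ih
      obtain ⟨h', hh', hj', hx⟩ := exists_mem_compactPerturbationsZero_map_eq hK
        (u := h (g j)) (w := j) (by rw [h.norm_map, g.norm_map]; exact hb.norm_eq j)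
        (hb.norm_eq j)
      refine ⟨h' * h, mul_mem hh' hh, fun i hit => ?_⟩
      rcases Finset.mem_insert.1 hit with rfl | hit
      · exact hj'
      · have hne : j ≠ i := fun h => hj (h ▸ hit)
        rw [mul_apply, hi i hit]
        refine hx _ ?_ (hb.orth j i hne)
        rw [← hi i hit]
        exact ((hb.orth j i hne).map g).map h
  obtain ⟨h, hh, hi⟩ := key Finset.univ
  have : h * g = 1 := hb.unitary_ext fun i => hi i (Finset.mem_univ i)
  rw [eq_inv_of_mul_eq_one_right this]
  exact inv_mem hh

end FiniteDimensional

/-- Pickrell's theorem over scalars with connected unit sphere. -/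
theorem isTrivial_of_hasConnectedUnits [CompleteSpace H] [SeparableSpace H]
    (hK : HasConnectedUnits K H) {V : Type*}
    [NormedAddCommGroup V] [InnerProductSpace ℂ V] [CompleteSpace V] [SeparableSpace V]
    (π : ContinuousUnitaryRep
      (UnitaryGroup K H ⧸ UnitaryGroup.compactPerturbationsZero K H) V) : π.IsTrivial := by
  by_cases hfin : FiniteDimensional ℝ H
  · intro g v
    obtain ⟨g, rfl⟩ := QuotientGroup.mk_surjective g
    rw [(QuotientGroup.eq_one_iff g).2 (compactPerturbationsZero_eq_top hK g), map_one]
    rfl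
  · exact isTrivial_of_infinite hfin π

end HilbertScalars

/-! ### The real, complex and quaternionic cases -/

namespace HilbertScalars

theorem of_real (H : Type*) [NormedAddCommGroup H] [InnerProductSpace ℝ H] :
    HilbertScalars ℝ H where
  exists_adjoint k := ⟨k, fun x y => by rw [real_inner_smul_left, real_inner_smul_right]⟩
  exists_frame := ⟨1, fun _ => 1, fun k => ⟨fun _ => k, by simp⟩, fun x m m' => by
    simp [Subsingleton.elim m m']⟩

section Complex

variable (H : Type*) [NormedAddCommGroup H] [InnerProductSpace ℂ H]

attribute [local instance] InnerProductSpace.complexToReal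

theorem of_complex : HilbertScalars ℂ H where
  exists_adjoint k := ⟨(starRingEnd ℂ) k, fun x y => by
    rw [real_inner_eq_re_inner ℂ, real_inner_eq_re_inner ℂ, inner_smul_left, inner_smul_right]⟩
  exists_frame := by
    refine ⟨2, ![1, Complex.I], fun k => ⟨![k.re, k.im], ?_⟩, fun x m m' => ?_⟩
    · simp [Complex.re_add_im]
    · rw [real_inner_eq_re_inner ℂ, inner_smul_left, inner_smul_right, inner_self_eq_norm_sq_to_K]
      fin_cases m <;> fin_cases m' <;> simp [← Complex.ofReal_pow]

/-- Isometric scalars are the unit circle, and spheres in real dimension greater than one are path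
connected. -/
theorem hasConnectedUnits_complex : HasConnectedUnits ℂ H where
  exists_inv k hk := ⟨k⁻¹, mul_inv_cancel₀ hk, inv_mul_cancel₀ hk⟩
  exists_path d hd q hq := by
    rw [norm_smul, hd, mul_one] at hq
    have hrank : 1 < Module.rank ℝ ℂ := by rw [Complex.rank_real_complex]; norm_num
    obtain ⟨γ, hγ⟩ := (isPathConnected_sphere hrank (0 : ℂ) zero_le_one).joinedIn 1 (by simp) q
      (by simpa using hq)
    refine ⟨γ, γ.source, γ.target, fun t => ?_, fun x => γ.continuous.smul continuous_const⟩
    rw [norm_smul, hd, mul_one]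
    simpa using hγ t

end Complex

section Quaternionic

variable {H : Type*} [NormedAddCommGroup H] [NormedSpace ℝ H] [Module ℍ[ℝ]ᵐᵒᵖ H]
  [IsScalarTower ℝ ℍ[ℝ]ᵐᵒᵖ H] [QuaternionicInnerProductSpace H]

open QuaternionicInnerProductSpace MulOpposite

theorem real_smul_eq_op_smul (r : ℝ) (x : H) : r • x = op (r : ℍ[ℝ]) • x := by
  rw [← algebraMap_smul ℍ[ℝ]ᵐᵒᵖ r x]
  rfl

variable (H) in
/-- The real inner product space underlying a quaternionic inner product space. -/
@[reducible]
noncomputable def quaternionicToReal : InnerProductSpace ℝ H :=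
  { ‹NormedSpace ℝ H› with
    inner := fun x y => (qinner x y).re
    norm_sq_eq_re_inner := fun x => by rw [qinner_self]; rfl
    conj_inner_symm := fun x y => by
      rw [← star_qinner x y]; simp
    add_left := fun x y z => by
      rw [← star_qinner z, ← star_qinner z, ← star_qinner z, qinner_add_right]; simp
    smul_left := fun x y r => by
      rw [← star_qinner y, ← star_qinner y, real_smul_eq_op_smul, qinner_smul_right]
      simp }

attribute [local instance] quaternionicToReal

theorem inner_op_smul_op_smul (a b : ℍ[ℝ]) (x y : H) :
    ⟪op a • x, op b • y⟫_ℝ = (star a * qinner x y * b).re := by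
  change (qinner (op a • x) (op b • y)).re = _
  rw [qinner_smul_right, ← star_qinner, qinner_smul_right, star_mul, star_qinner]

/-- As `qinner x x` is real, it is central and factors out, leaving the real part of `star a * b`,
the Euclidean inner product on `ℝ⁴`. -/
theorem inner_op_smul_op_smul_self (a b : ℍ[ℝ]) (x : H) : ⟪op a • x, op b • x⟫_ℝ =
    (a.re * b.re + a.imI * b.imI + a.imJ * b.imJ + a.imK * b.imK) * ‖x‖ ^ 2 := by
  rw [inner_op_smul_op_smul, qinner_self, ← Quaternion.coe_commutes, mul_assoc,
    Quaternion.coe_mul_eq_smul, Quaternion.re_smul, Quaternion.re_mul, smul_eq_mul]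
  simp
  ring

theorem norm_op_smul (a : ℍ[ℝ]) (x : H) : ‖op a • x‖ = ‖a‖ * ‖x‖ := by
  refine (sq_eq_sq₀ (norm_nonneg _) (by positivity)).1 ?_
  rw [← real_inner_self_eq_norm_sq, inner_op_smul_op_smul_self, mul_pow, sq ‖a‖,
    ← Quaternion.normSq_eq_norm_mul_self, Quaternion.normSq_def']
  ring

variable (H) in
theorem of_quaternion : HilbertScalars ℍ[ℝ]ᵐᵒᵖ H where
  exists_adjoint k := ⟨op (star k.unop), fun x y => by
    have h1 := inner_op_smul_op_smul k.unop 1 x y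
    have h2 := inner_op_smul_op_smul 1 (star k.unop) x y
    simp only [op_unop, op_one, one_smul, star_one, one_mul, mul_one] at h1 h2
    rw [h1, h2]
    simp
    ring⟩
  exists_frame := by
    let u : Fin 4 → ℍ[ℝ] := ![⟨1, 0, 0, 0⟩, ⟨0, 1, 0, 0⟩, ⟨0, 0, 1, 0⟩, ⟨0, 0, 0, 1⟩]
    refine ⟨4, fun m => op (u m),
      fun k => ⟨![k.unop.re, k.unop.imI, k.unop.imJ, k.unop.imK], ?_⟩, fun x m m' => ?_⟩
    · rw [← unop_inj]
      simp only [Fin.sum_univ_four, unop_add, unop_smul, unop_op]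
      ext
      · simp only [Quaternion.re_add, Quaternion.re_smul]; simp [u]
      · simp only [Quaternion.imI_add, Quaternion.imI_smul]; simp [u]
      · simp only [Quaternion.imJ_add, Quaternion.imJ_smul]; simp [u]
      · simp only [Quaternion.imK_add, Quaternion.imK_smul]; simp [u]
    · rw [inner_op_smul_op_smul_self]
      fin_cases m <;> fin_cases m' <;> simp [u]

variable (H) in
theorem hasConnectedUnits_quaternion : HasConnectedUnits ℍ[ℝ]ᵐᵒᵖ H where
  exists_inv k hk := ⟨k⁻¹, mul_inv_cancel₀ hk, inv_mul_cancel₀ hk⟩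
  exists_path d hd q hq := by
    have hq' : ‖q.unop‖ = 1 := by
      have := norm_op_smul q.unop d
      rw [op_unop, hq, hd, mul_one] at this
      exact this.symm
    have hrank : 1 < Module.rank ℝ ℍ[ℝ] := by rw [Quaternion.rank_eq_four]; norm_num
    obtain ⟨γ, hγ⟩ := (isPathConnected_sphere hrank (0 : ℍ[ℝ]) zero_le_one).joinedIn 1 (by simp)
      q.unop (by simpa using hq')
    refine ⟨fun t => op (γ t), by simp, by simp, fun t => ?_, fun x => ?_⟩
    · rw [norm_op_smul, hd, mul_one]
      simpa using hγ t
    -- Continuity of scalar multiplication in the scalar is obtained from `norm_op_smul`, which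
    -- makes the additive map `L` bounded.
    · let L : ℍ[ℝ] →+ H :=
        { toFun := fun a => op a • x
          map_zero' := by simp
          map_add' := fun a b => by rw [op_add, add_smul] }
      have hL : Continuous L := AddMonoidHomClass.continuous_of_bound L ‖x‖ fun a => by
        change ‖op a • x‖ ≤ _
        rw [norm_op_smul, mul_comm]
      exact hL.comp γ.continuous

end Quaternionic

end HilbertScalars

theorem theorem4p5 :
    (∀ (H : Type u) [NormedAddCommGroup H] [InnerProductSpace ℝ H] [CompleteSpace H]
      [SeparableSpace H], ¬ FiniteDimensional ℝ H →
      ∀ (V : Type v) [NormedAddCommGroup V] [InnerProductSpace ℂ V] [CompleteSpace V]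
        [SeparableSpace V]
        (π : ContinuousUnitaryRep
          (UnitaryGroup ℝ H ⧸ UnitaryGroup.compactPerturbationsZero ℝ H) V),
        π.IsTrivial) ∧
    (∀ (H : Type u) [NormedAddCommGroup H] [InnerProductSpace ℂ H] [CompleteSpace H]
      [SeparableSpace H]
      (V : Type v) [NormedAddCommGroup V] [InnerProductSpace ℂ V] [CompleteSpace V]
        [SeparableSpace V]
        (π : ContinuousUnitaryRep
          (UnitaryGroup ℂ H ⧸ UnitaryGroup.compactPerturbationsZero ℂ H) V),
        π.IsTrivial) ∧
    (∀ (H : Type u) [NormedAddCommGroup H] [NormedSpace ℝ H] [Module ℍ[ℝ]ᵐᵒᵖ H]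
      [IsScalarTower ℝ ℍ[ℝ]ᵐᵒᵖ H] [QuaternionicInnerProductSpace H] [CompleteSpace H]
      [SeparableSpace H]
      (V : Type v) [NormedAddCommGroup V] [InnerProductSpace ℂ V] [CompleteSpace V]
        [SeparableSpace V]
        (π : ContinuousUnitaryRep
          (UnitaryGroup ℍ[ℝ]ᵐᵒᵖ H ⧸ UnitaryGroup.compactPerturbationsZero ℍ[ℝ]ᵐᵒᵖ H) V),
        π.IsTrivial) := by
  refine ⟨?_, ?_, ?_⟩
  · intro H _ _ _ _ hinf V _ _ _ _ π
    have := HilbertScalars.of_real H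
    exact HilbertScalars.isTrivial_of_infinite hinf π
  · intro H _ _ _ _ V _ _ _ _ π
    let _ := InnerProductSpace.complexToReal (G := H)
    have := HilbertScalars.of_complex H
    exact HilbertScalars.isTrivial_of_hasConnectedUnits
      (HilbertScalars.hasConnectedUnits_complex H) π
  · intro H _ _ _ _ _ _ _ V _ _ _ _ π
    let _ := HilbertScalars.quaternionicToReal H
    have := HilbertScalars.of_quaternion H
    exact HilbertScalars.isTrivial_of_hasConnectedUnits
      (HilbertScalars.hasConnectedUnits_quaternion H) π
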